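/- A concurrent program $P=(S_1,\dots,S_k)$, $k\ge 1$, consists of $k$ threads, each a nonempty finite sequence of operations $\mathtt r(x,d)$ (read value $d$ from variable $x$) or $\mathtt w(x,d)$ (write value $d$ to variable $x$); an occurrence of an operation in a thread is an event, and $n$ is the total number of events. An interleaving of $P$ is an enumeration of all events, each exactly once, that respects the order of the events within every thread. It is sequentially consistent if every read $\mathtt r(x,d)$ in it is preceded by some $\mathtt w(x,d)$ with no $\mathtt w(x,d')$, $d'\neq d$, in between. A preemption occurs at a position $j$ of an interleaving $a_1\cdots a_n$, $1\le j<n$, if $a_j$ and $a_{j+1}$ belong to different threads and $a_j$ is not the last event of its thread. For a fixed $\pi\ge 0$, the problem $\mathrm{VSC}^{\pi}$ asks, given $P$, whether $P$ has a sequentially consistent interleaving with at most $\pi$ preemptions. $P$ is a 1-Writer program if no variable is written by two different threads. **Theorem.** For every fixed $\pi\ge 0$, $\mathrm{VSC}^{\pi}$ on 1-Writer programs can be decided in polynomial time. More precisely, there is a constant $C$ such that for every $\pi\ge 0$ there is a program of a unit-cost random access machine (with addition and truncated subtraction as its only arithmetic, variables and values being given as natural numbers) that on every 1-Writer program $P$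 with $n$ events and $k$ threads halts after at most $$C\cdot n^{\pi+1}\cdot k\cdot\max(\pi,1)\cdot\pi!$$ steps with the correct answer to $\mathrm{VSC}^{\pi}$. -/

import Mathlib

/-! ### Concurrent programs and the problem -/

/-- Memory operations `r(x, d)` and `w(x, d)`; variables and values are named by natural numbers. -/
inductive MemOp where
  | read (x d : ℕ)
  | write (x d : ℕ)
  deriving DecidableEq

/-- A concurrent program: a nonempty finite list of threads, each of which is a nonempty finite
sequence of memory operations. The identifier of a thread is its index in the list. -/
structure ConcProg where
  threads : List (List MemOp)
  threads_ne : threads ≠ []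
  thread_ne : ∀ S ∈ threads, S ≠ []

namespace ConcProg

/-- The number of threads, `k`. -/
def numThreads (P : ConcProg) : ℕ := P.threads.length

/-- The total number of events of all threads, `n`. -/
def numEvents (P : ConcProg) : ℕ := (P.threads.map List.length).sum

/-- An event: the occurrence of an operation at position `e.2` of thread `e.1`. -/
abbrev Event (P : ConcProg) : Type :=
  (i : Fin P.threads.length) × Fin (P.threads.get i).length

/-- The memory operation performed by an event. -/
def op (P : ConcProg) (e : P.Event) : MemOp := (P.threads.get e.1).get e.2

/-- `e` comes before `f` in the same thread. -/
def ProgramOrder (P : ConcProg) (e f : P.Event) : Prop :=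
  e.1 = f.1 ∧ e.2.val < f.2.val

/-- `e` is the last event of its thread. -/
def IsLast (P : ConcProg) (e : P.Event) : Prop :=
  e.2.val + 1 = (P.threads.get e.1).length

/-- An interleaving: an enumeration of all events, each exactly once, in which no event comes
before one of its predecessors in program order. -/
def IsInterleaving (P : ConcProg) (σ : List P.Event) : Prop :=
  σ.Nodup ∧ (∀ e, e ∈ σ) ∧ σ.Pairwise (fun e f => ¬ P.ProgramOrder f e)

/-- For every read `r(x, d)` (at position `p`) there is a preceding write `w(x, d)` (at position
`q`) with no write `w(x, d')`, `d' ≠ d`, in between. -/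
def SeqConsistent (P : ConcProg) (σ : List P.Event) : Prop :=
  ∀ (p : Fin σ.length) (x d : ℕ), P.op (σ.get p) = MemOp.read x d →
    ∃ q : Fin σ.length, q < p ∧ P.op (σ.get q) = MemOp.write x d ∧
      ∀ r : Fin σ.length, q < r → r < p → ∀ d' : ℕ, d' ≠ d → P.op (σ.get r) ≠ MemOp.write x d'

/-- A preemption occurs at position `j` if the events at positions `j` and `j + 1` belong to
different threads and the one at `j` is not the last event of its thread. -/
def PreemptionAt (P : ConcProg) (σ : List P.Event) (j : ℕ) : Prop :=
  ∃ h : j + 1 < σ.length,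
    (σ.get ⟨j, Nat.lt_of_succ_lt h⟩).1 ≠ (σ.get ⟨j + 1, h⟩).1 ∧
      ¬ P.IsLast (σ.get ⟨j, Nat.lt_of_succ_lt h⟩)

open Classical in
/-- The number of preemptions in `σ`. -/
noncomputable def numPreemptions (P : ConcProg) (σ : List P.Event) : ℕ :=
  ((Finset.range σ.length).filter (fun j => P.PreemptionAt σ j)).card

/-- The question asked by the problem: is there a sequentially consistent interleaving with at
most `b` preemptions? -/
def VSC (b : ℕ) (P : ConcProg) : Prop :=
  ∃ σ : List P.Event, P.IsInterleaving σ ∧ P.SeqConsistent σ ∧ P.numPreemptions σ ≤ b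

/-- No variable is written by two different threads. -/
def OneWriter (P : ConcProg) : Prop :=
  ∀ (e f : P.Event) (x d d' : ℕ),
    P.op e = MemOp.write x d → P.op f = MemOp.write x d' → e.1 = f.1

end ConcProg

/-! ### Input encoding -/

/-- Three numbers per operation: kind (`0` for read, `1` for write), variable, value. -/
def MemOp.encode : MemOp → List ℕ
  | .read x d => [0, x, d]
  | .write x d => [1, x, d]

/-- The number of threads, then for every thread its length followed by its operations. -/
def ConcProg.encode (P : ConcProg) : List ℕ :=
  P.threads.length :: P.threads.flatMap (fun S => S.length :: S.flatMap MemOp.encode)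

/-! ### Random access machine

A unit-cost random access machine: registers and an indirectly addressed memory, both holding
natural numbers; the arithmetic is addition and truncated subtraction only (no multiplication, so
that polynomially many steps amount to polynomial time on a Turing machine). Programs are written
in structured form. -/

namespace RAM

/-- A register file and a memory. -/
structure State where
  reg : ℕ → ℕ
  mem : ℕ → ℕ

/-- Machine programs. -/
inductive Prog where
  | skip
  /-- `reg r := c` -/
  | const (r c : ℕ)
  /-- `reg r := reg s` -/
  | move (r s : ℕ)
  /-- `reg r := reg s + reg t` -/
  | add (r s t : ℕ)
  /-- `reg r := reg s - reg t` (truncated at `0`) -/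
  | sub (r s t : ℕ)
  /-- `reg r := mem (reg s)` -/
  | load (r s : ℕ)
  /-- `mem (reg r) := reg s` -/
  | store (r s : ℕ)
  | seq (A B : Prog)
  /-- if `reg r ≠ 0` then `A` else `B` -/
  | cond (r : ℕ) (A B : Prog)
  /-- while `reg r ≠ 0` do `A` -/
  | loop (r : ℕ) (A : Prog)

/-- Assign `v` to register `r`. -/
def State.setReg (s : State) (r v : ℕ) : State := ⟨Function.update s.reg r v, s.mem⟩

/-- Assign `v` to memory cell `a`. -/
def State.setMem (s : State) (a v : ℕ) : State := ⟨s.reg, Function.update s.mem a v⟩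

/-- `Exec A s s' t`: started in state `s`, the program `A` halts in state `s'` after exactly `t`
steps. Every elementary instruction and every test of a conditional or loop is one step. -/
inductive Exec : Prog → State → State → ℕ → Prop
  | skip (s : State) : Exec .skip s s 1
  | const (s : State) (r c : ℕ) : Exec (.const r c) s (s.setReg r c) 1
  | move (s : State) (r u : ℕ) : Exec (.move r u) s (s.setReg r (s.reg u)) 1
  | add (s : State) (r u v : ℕ) : Exec (.add r u v) s (s.setReg r (s.reg u + s.reg v)) 1
  | sub (s : State) (r u v : ℕ) : Exec (.sub r u v) s (s.setReg r (s.reg u - s.reg v)) 1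
  | load (s : State) (r u : ℕ) : Exec (.load r u) s (s.setReg r (s.mem (s.reg u))) 1
  | store (s : State) (r u : ℕ) : Exec (.store r u) s (s.setMem (s.reg r) (s.reg u)) 1
  | seq {A B : Prog} {s s' s'' : State} {t t' : ℕ} :
      Exec A s s' t → Exec B s' s'' t' → Exec (.seq A B) s s'' (t + t')
  | cond_true {r : ℕ} {A B : Prog} {s s' : State} {t : ℕ} :
      s.reg r ≠ 0 → Exec A s s' t → Exec (.cond r A B) s s' (t + 1)
  | cond_false {r : ℕ} {A B : Prog} {s s' : State} {t : ℕ} :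
      s.reg r = 0 → Exec B s s' t → Exec (.cond r A B) s s' (t + 1)
  | loop_done {r : ℕ} {A : Prog} {s : State} :
      s.reg r = 0 → Exec (.loop r A) s s 1
  | loop_step {r : ℕ} {A : Prog} {s s' s'' : State} {t t' : ℕ} :
      s.reg r ≠ 0 → Exec A s s' t → Exec (.loop r A) s' s'' t' →
        Exec (.loop r A) s s'' (t + t' + 1)

/-- The initial state on input `l`: all registers are `0`, the memory holds the entries of `l` in
the cells `0, …, l.length - 1` and `0` in all others. -/
def init (l : List ℕ) : State := ⟨fun _ => 0, fun a => l.getD a 0⟩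

/-- On input `l`, the program `A` halts within `T` steps, with output (the content of register `0`)
equal to `1` if `Q` holds and to `0` otherwise. -/
def AnswersWithin (A : Prog) (l : List ℕ) (Q : Prop) (T : ℕ) : Prop :=
  ∃ (s : State) (t : ℕ), Exec A (init l) s t ∧ t ≤ T ∧
    (Q → s.reg 0 = 1) ∧ (¬ Q → s.reg 0 = 0)

end RAM

namespace ConcProg

variable {P : ConcProg}

/-! ### Down-closed sets of events and blocks -/

/-! Under the 1-Writer condition the memory depends only on the set `D` of executed events: all
writes to `x` lie in one thread, so the last of them in `D` is determined, whatever the order of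
execution. An interleaving becomes a sequence of blocks, each running one thread up to some event.
`vsc_iff_completable` turns the question into `Completable ∅ b`, where blocks that finish their
thread are free and the others are charged.

Blocks that finish a thread need no guessing. Thread `i` is runnable if its pending reads of
variables it does not write see the right values now, and all pending reads of its variables
elsewhere ask for the final values. Such a thread can be moved to the front of any completion
(`Completable.union_ofThread`): the other reads still succeed, and the blocks of `i` disappear, so
no preemption is added. Its reads of its own variables see the same values whenever it runs, so if
one fails there is no completion at all. Hence running it to its end is an equivalence
(`completable_iff_of_runnable`). Conversely, a block that finishes a thread can come next only if
that thread is runnable (`Completable.of_stuck`). So runnable threads are run greedily, in at most k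
rounds; if events remain, the next block is a charged one, and its last event is one of n.

This gives the procedure: for each of the n^b tuples of events, alternate saturation with the block
of the next guessed event, and accept if all events were executed without a failed read. A round
consists of a constant number of scans, a saturation costs O(nk), and the total is O(n^(b+1) · k ·
max(b,1)); the factor b! is not needed.

For the machine, the procedure is written in a small language with tables and loops whose iteration
count is fixed on entry. `exec_compile` simulates it with an exact step count, and `cost_le_bound`
bounds this count by an expression read off the syntax. -/

theorem Event.ext_val {e f : P.Event} (h : e.1 = f.1) (hval : e.2.val = f.2.val) : e = f := by
  obtain ⟨i, p⟩ := e
  obtain ⟨j, q⟩ := f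
  obtain rfl : i = j := h
  obtain rfl : p = q := Fin.ext hval
  rfl

/-- The events of thread `a.1` up to `a` that are not in `D`. -/
def block (D : Set P.Event) (a : P.Event) : Set P.Event :=
  {e | e ∉ D ∧ e.1 = a.1 ∧ e.2.val ≤ a.2.val}

/-- All events of thread `i`. -/
def ofThread (P : ConcProg) (i : Fin P.threads.length) : Set P.Event := {e | e.1 = i}

/-- After the events in `D`, the variable `x` has value `d`. -/
def Holds (D : Set P.Event) (x d : ℕ) : Prop :=
  ∃ f ∈ D, P.op f = .write x d ∧
    ∀ g ∈ D, ∀ d', d' ≠ d → P.op g = .write x d' → ¬ P.ProgramOrder f g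

/-- The event `e` can be executed after the events in `D`. -/
def Enabled (D : Set P.Event) (e : P.Event) : Prop :=
  ∀ x d, P.op e = .read x d → Holds D x d

/-- The block of `a` can be executed after the events in `D`. -/
def BlockEnabled (D : Set P.Event) (a : P.Event) : Prop :=
  ∀ e ∈ block D a, Enabled (D ∪ {f | f ∈ block D a ∧ P.ProgramOrder f e}) e

def DownClosed (D : Set P.Event) : Prop := ∀ e f, P.ProgramOrder e f → f ∈ D → e ∈ D

/-- From the events in `D` one can complete the execution by blocks of which at most `m` do not
end with the last event of their thread. -/
inductive Completable : Set P.Event → ℕ → Prop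
  | done (m : ℕ) : Completable Set.univ m
  | last {D : Set P.Event} {m : ℕ} (a : P.Event) : a ∉ D → P.IsLast a → BlockEnabled D a →
      Completable (D ∪ block D a) m → Completable D m
  | preempt {D : Set P.Event} {m : ℕ} (a : P.Event) : a ∉ D → BlockEnabled D a →
      Completable (D ∪ block D a) m → Completable D (m + 1)

theorem Completable.mono {D : Set P.Event} {m m' : ℕ} (h : Completable D m) (hm : m ≤ m') :
    Completable D m' := by
  induction h generalizing m' with
  | done => exact .done _
  | last a ha hl hb _ ih => exact .last a ha hl hb (ih hm)
  | preempt a ha hb _ ih =>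
    obtain ⟨m', rfl⟩ : ∃ q, m' = q + 1 := ⟨m' - 1, by omega⟩
    exact .preempt a ha hb (ih (by omega))

theorem downClosed_empty : DownClosed (∅ : Set P.Event) := fun _ _ _ h => h.elim

theorem downClosed_union_block {D : Set P.Event} (hD : DownClosed D) (a : P.Event) :
    DownClosed (D ∪ block D a) := by
  rintro e f ⟨h1, h2⟩ (hf | ⟨_, hf, hf'⟩)
  · exact .inl (hD e f ⟨h1, h2⟩ hf)
  · by_cases he : e ∈ D
    · exact .inl he
    · exact .inr ⟨he, h1.trans hf, by omega⟩

theorem mem_union_block {D : Set P.Event} {a e : P.Event} :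
    e ∈ D ∪ block D a ↔ e ∈ D ∨ (e.1 = a.1 ∧ e.2.val ≤ a.2.val) := by
  simp only [Set.mem_union, block, Set.mem_ofPred_eq]
  tauto

theorem union_block_last {D : Set P.Event} {a : P.Event} (ha : P.IsLast a) :
    D ∪ block D a = D ∪ P.ofThread a.1 := by
  ext e
  rw [mem_union_block]
  simp only [Set.mem_union, ofThread, Set.mem_ofPred_eq]
  have : e.1 = a.1 → e.2.val ≤ a.2.val := by
    intro h
    have h1 := e.2.isLt
    unfold IsLast at ha
    have : (P.threads.get e.1).length = (P.threads.get a.1).length := by rw [h]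
    omega
  tauto

theorem block_eq_empty {D : Set P.Event} (hD : DownClosed D) {a : P.Event} (ha : a ∈ D) :
    block D a = ∅ := by
  ext e
  simp only [block, Set.mem_ofPred_eq, Set.mem_empty_iff_false, iff_false, not_and]
  intro he h1 h2
  rcases h2.lt_or_eq with h | h
  · exact he (hD e a ⟨h1, h⟩ ha)
  · exact he (Event.ext_val h1 h ▸ ha)

theorem holds_congr {D D' : Set P.Event} {x d : ℕ}
    (h : ∀ f d', P.op f = .write x d' → (f ∈ D ↔ f ∈ D')) : Holds D x d ↔ Holds D' x d := by
  constructor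
  · rintro ⟨f, hf, hw, hg⟩
    exact ⟨f, (h f d hw).1 hf, hw, fun g hgD d' hd hgw => hg g ((h g d' hgw).2 hgD) d' hd hgw⟩
  · rintro ⟨f, hf, hw, hg⟩
    exact ⟨f, (h f d hw).2 hf, hw, fun g hgD d' hd hgw => hg g ((h g d' hgw).1 hgD) d' hd hgw⟩

/-- By the 1-Writer condition the two witnessing writes belong to one thread, hence are comparable
in program order, and the later one contradicts the maximality of the earlier. -/
theorem Holds.unique (hP : P.OneWriter) {D : Set P.Event} {x d d' : ℕ} (h : Holds D x d)
    (h' : Holds D x d') : d = d' := by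
  obtain ⟨f, hf, hw, hg⟩ := h
  obtain ⟨f', hf', hw', hg'⟩ := h'
  by_contra hne
  have h1 := hg f' hf' d' (Ne.symm hne) hw'
  have h2 := hg' f hf d hne hw
  have ht := hP f f' x d d' hw hw'
  rcases lt_trichotomy f.2.val f'.2.val with h | h | h
  · exact h1 ⟨ht, h⟩
  · obtain rfl := Event.ext_val ht h
    rw [hw] at hw'
    cases hw'
    exact hne rfl
  · exact h2 ⟨ht.symm, h⟩

/-- Executing a write to `x` makes its value the value of `x`. -/
theorem holds_insert_write (hP : P.OneWriter) {D : Set P.Event} {e : P.Event} {x d₀ : ℕ}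
    (he : P.op e = .write x d₀) (hD : ∀ f ∈ D, ¬ P.ProgramOrder e f) (d : ℕ) :
    Holds (insert e D) x d ↔ d = d₀ := by
  have key : Holds (insert e D) x d₀ := by
    refine ⟨e, Set.mem_insert _ _, he, fun g hg d' hd hw => ?_⟩
    rcases hg with rfl | hg
    · exact fun h => lt_irrefl _ h.2
    · exact hD g hg
  exact ⟨fun h => h.unique hP key, fun h => h ▸ key⟩

theorem holds_insert_of_ne {D : Set P.Event} {e : P.Event} {x : ℕ}
    (he : ∀ d, P.op e ≠ .write x d) (d : ℕ) : Holds (insert e D) x d ↔ Holds D x d :=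
  holds_congr fun f d' hf => by
    have : f ≠ e := fun h => he d' (h ▸ hf)
    simp [this]

/-! ### Threads that can safely be run to their end -/

/-- Some event of thread `i` writes `x`. -/
def Writes (i : Fin P.threads.length) (x : ℕ) : Prop := ∃ e d, e.1 = i ∧ P.op e = .write x d

/-- Thread `i` is unfinished and can be run to its end, and all reads of its variables that
remain in other threads ask for the final value. -/
def Runnable (D : Set P.Event) (i : Fin P.threads.length) : Prop :=
  (∃ e, e ∉ D ∧ e.1 = i) ∧
  (∀ e, e ∉ D → e.1 = i → ∀ x d, P.op e = .read x d → ¬ Writes i x → Holds D x d) ∧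
  (∀ e, e ∉ D → e.1 ≠ i → ∀ x d, P.op e = .read x d → Writes i x →
    Holds (Set.univ : Set P.Event) x d)

/-- Once the writer of `x` is finished, no further write to `x` can come, so the current value is
the final one. -/
theorem holds_univ_iff (hP : P.OneWriter) {D : Set P.Event} {i : Fin P.threads.length} {x d : ℕ}
    (hw : Writes i x) (hi : ∀ e : P.Event, e.1 = i → e ∈ D) :
    Holds D x d ↔ Holds (Set.univ : Set P.Event) x d :=
  holds_congr fun f d' hf => by
    obtain ⟨e, d₁, he, hwe⟩ := hw
    simp [hi f ((hP f e x d' d₁ hf hwe).trans he)]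

/-- Isolates the moment at which a completion executes the pending event `e`. The set `D'` executed
before that moment contains exactly the predecessors of `e` from its own thread; about the other
threads only `D ⊆ D'` is known. This suffices for reads of variables of the own thread and of
variables whose writer is already finished. -/
theorem Completable.exists_enabled {D : Set P.Event} {m : ℕ} (h : Completable D m)
    (hD : DownClosed D) {e : P.Event} (he : e ∉ D) :
    ∃ D', D ⊆ D' ∧ (∀ f, f.1 = e.1 → (f ∈ D' ↔ P.ProgramOrder f e)) ∧ Enabled D' e := by
  have step : ∀ (D : Set P.Event) (a : P.Event), DownClosed D → BlockEnabled D a → e ∉ D →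
      e ∈ block D a →
      ∃ D', D ⊆ D' ∧ (∀ f, f.1 = e.1 → (f ∈ D' ↔ P.ProgramOrder f e)) ∧ Enabled D' e := by
    intro D a hD hb he hea
    refine ⟨_, Set.subset_union_left, ?_, hb e hea⟩
    intro f hf
    constructor
    · rintro (hfD | hf')
      · refine ⟨hf, ?_⟩
        by_contra hlt
        rcases (not_lt.1 hlt).lt_or_eq with h | h
        · exact he (hD e f ⟨hf.symm, h⟩ hfD)
        · exact he (Event.ext_val hf.symm h ▸ hfD)
      · exact hf'.2
    · intro hpo
      by_cases hfD : f ∈ D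
      · exact .inl hfD
      · exact .inr ⟨⟨hfD, hf.trans hea.2.1, hpo.2.le.trans hea.2.2⟩, hpo⟩
  induction h with
  | done => exact (he trivial).elim
  | @last D m a ha hl hb _ ih =>
    by_cases hea : e ∈ block D a
    · exact step D a hD hb he hea
    · obtain ⟨D', h1, h2⟩ := ih (downClosed_union_block hD a) (fun h => h.elim he hea)
      exact ⟨D', Set.subset_union_left.trans h1, h2⟩
  | @preempt D m a ha hb _ ih =>
    by_cases hea : e ∈ block D a
    · exact step D a hD hb he hea
    · obtain ⟨D', h1, h2⟩ := ih (downClosed_union_block hD a) (fun h => h.elim he hea)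
      exact ⟨D', Set.subset_union_left.trans h1, h2⟩

/-- If all remaining reads of the variables of thread `i` in other threads ask for the final
values, then thread `i` may be completed first. -/
theorem Completable.union_ofThread (hP : P.OneWriter) {i : Fin P.threads.length}
    {D : Set P.Event} {m : ℕ} (h : Completable D m)
    (hi : ∀ e, e ∉ D → e.1 ≠ i → ∀ x d, P.op e = .read x d → Writes i x →
      Holds (Set.univ : Set P.Event) x d) :
    Completable (D ∪ P.ofThread i) m := by
  have same : ∀ (D : Set P.Event) (a : P.Event), a.1 = i →
      D ∪ block D a ∪ P.ofThread i = D ∪ P.ofThread i := by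
    intro D a ha
    ext e
    rw [Set.mem_union, mem_union_block]
    simp only [Set.mem_union, ofThread, Set.mem_ofPred_eq, ha]
    tauto
  have blk : ∀ (D : Set P.Event) (a : P.Event), a.1 ≠ i →
      block (D ∪ P.ofThread i) a = block D a := by
    intro D a ha
    ext e
    simp only [block, ofThread, Set.mem_union, Set.mem_ofPred_eq, not_or]
    constructor
    · rintro ⟨⟨h1, -⟩, h2⟩
      exact ⟨h1, h2⟩
    · rintro ⟨h1, h2, h3⟩
      exact ⟨⟨h1, fun h => ha (h2 ▸ h)⟩, h2, h3⟩
  have comm : ∀ (D : Set P.Event) (a : P.Event), a.1 ≠ i →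
      D ∪ block D a ∪ P.ofThread i = D ∪ P.ofThread i ∪ block (D ∪ P.ofThread i) a := by
    intro D a ha
    rw [blk D a ha, Set.union_right_comm]
  -- A read of a variable of `i` asks for the final value, which is present since thread `i` is
  -- finished; any other read does not notice the events of `i`.
  have enab : ∀ (D : Set P.Event) (a : P.Event), a.1 ≠ i → BlockEnabled D a →
      (∀ e, e ∉ D → e.1 ≠ i → ∀ x d, P.op e = .read x d → Writes i x →
        Holds (Set.univ : Set P.Event) x d) → BlockEnabled (D ∪ P.ofThread i) a := by
    intro D a ha hb hi e he x d hop
    rw [blk D a ha] at he ⊢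
    have hne : e.1 ≠ i := he.2.1 ▸ ha
    by_cases hw : Writes i x
    · rw [holds_univ_iff hP hw fun f hf => .inl (.inr hf)]
      exact hi e he.1 hne x d hop hw
    · refine (holds_congr fun f d' hf => ?_).1 (hb e he x d hop)
      have : f ∉ P.ofThread i := fun h => hw ⟨f, d', h, hf⟩
      simp [this]
  induction h with
  | done => rw [Set.univ_union]; exact .done _
  | @last D m a ha hl hb _ ih =>
    have ih' := ih fun e he => hi e fun h => he (.inl h)
    by_cases hai : a.1 = i
    · rwa [same D a hai] at ih'
    · rw [comm D a hai] at ih'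
      exact .last a (fun h => h.elim ha hai) hl (enab D a hai hb hi) ih'
  | @preempt D m a ha hb _ ih =>
    have ih' := ih fun e he => hi e fun h => he (.inl h)
    by_cases hai : a.1 = i
    -- A block of thread `i` is absorbed by the part already run; the preemption it was charged for
    -- is saved.
    · rw [same D a hai] at ih'
      exact ih'.mono (Nat.le_succ _)
    · rw [comm D a hai] at ih'
      exact .preempt a (fun h => h.elim ha hai) (enab D a hai hb hi) ih'

theorem Runnable.not_mem {D : Set P.Event} (hD : DownClosed D) {a : P.Event}
    (h : Runnable D a.1) (ha : P.IsLast a) : a ∉ D := by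
  obtain ⟨⟨e, he, hea⟩, -⟩ := h
  intro haD
  have : e ∈ D ∪ block D a := by
    rw [union_block_last ha]
    exact .inr hea
  rw [block_eq_empty hD haD] at this
  simp [he] at this

/-- For a variable of the own thread, the value seen by a read is fixed by its predecessors in that
thread, so it is the value seen in the given completion. For other variables runnability gives the
value in `D`, and the block itself does not write them. -/
theorem Completable.blockEnabled (hP : P.OneWriter) {D : Set P.Event} {m : ℕ}
    (h : Completable D m) (hD : DownClosed D) {a : P.Event} (hr : Runnable D a.1) :
    BlockEnabled D a := by
  intro e he x d hop
  by_cases hw : Writes a.1 x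
  · obtain ⟨D', -, h2, h3⟩ := h.exists_enabled hD he.1
    refine (holds_congr fun f d' hf => ?_).1 (h3 x d hop)
    obtain ⟨g, d₁, hg, hgw⟩ := hw
    have hfe : f.1 = e.1 := ((hP f g x d' d₁ hf hgw).trans hg).trans he.2.1.symm
    rw [h2 f hfe]
    constructor
    · intro hpo
      by_cases hfD : f ∈ D
      · exact .inl hfD
      · exact .inr ⟨⟨hfD, hfe.trans he.2.1, hpo.2.le.trans he.2.2⟩, hpo⟩
    · rintro (hfD | hf')
      · refine ⟨hfe, ?_⟩
        by_contra hlt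
        rcases (not_lt.1 hlt).lt_or_eq with h | h
        · exact he.1 (hD e f ⟨hfe.symm, h⟩ hfD)
        · exact he.1 (Event.ext_val hfe.symm h ▸ hfD)
      · exact hf'.2
  · refine (holds_congr fun f d' hf => ?_).1 (hr.2.1 e he.1 he.2.1 x d hop hw)
    constructor
    · exact .inl
    · rintro (hfD | hf')
      · exact hfD
      · exact (hw ⟨f, d', hf'.1.2.1, hf⟩).elim

/-- Running a runnable thread to its end changes nothing about completability. -/
theorem completable_iff_of_runnable (hP : P.OneWriter) {D : Set P.Event} {m : ℕ}
    (hD : DownClosed D) {a : P.Event} (hr : Runnable D a.1) (ha : P.IsLast a) :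
    Completable D m ↔ BlockEnabled D a ∧ Completable (D ∪ block D a) m := by
  constructor
  · intro h
    refine ⟨h.blockEnabled hP hD hr, ?_⟩
    rw [union_block_last ha]
    exact h.union_ofThread hP hr.2.2
  · rintro ⟨hb, h⟩
    exact .last a (hr.not_mem hD ha) ha hb h

/-- If no thread is runnable, the next block must be a preempted one. -/
theorem Completable.of_stuck (hP : P.OneWriter) {D : Set P.Event} {m : ℕ}
    (h : Completable D m) (hD : DownClosed D) (hs : ∀ i, ¬ Runnable D i) :
    D = Set.univ ∨ ∃ q a, m = q + 1 ∧ BlockEnabled D a ∧ Completable (D ∪ block D a) q := by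
  cases h with
  | done => exact .inl rfl
  | preempt a ha hb h => exact .inr ⟨_, a, rfl, hb, h⟩
  | last a ha hl hb h =>
    -- A block that finishes its thread proves the thread runnable: its reads of foreign variables
    -- succeed, and the block does not change these variables; all remaining reads of other threads
    -- happen after the thread is finished and so see final values of its variables.
    refine (hs a.1 ⟨⟨a, ha, rfl⟩, ?_, ?_⟩).elim
    · intro e he hea x d hop hw
      have heb : e ∈ block D a := by
        have : e ∈ D ∪ block D a := by
          rw [union_block_last hl]
          exact .inr hea
        exact this.resolve_left he
      refine (holds_congr fun f d' hf => ?_).1 (hb e heb x d hop)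
      constructor
      · rintro (hfD | hf')
        · exact hfD
        · exact (hw ⟨f, d', hf'.1.2.1, hf⟩).elim
      · exact .inl
    · intro e he hea x d hop hw
      obtain ⟨D', h1, -, h3⟩ := h.exists_enabled (downClosed_union_block hD a) (e := e)
        (by rw [mem_union_block]; tauto)
      refine (holds_univ_iff hP hw fun f hf => h1 ?_).1 (h3 x d hop)
      rw [union_block_last hl]
      exact .inr hf

/-! ### Interleavings as sequences of blocks -/

/-- `τ` can be executed event by event after the events in `D`. -/
def Executable : Set P.Event → List P.Event → Prop
  | _, [] => True
  | D, e :: τ => e ∉ D ∧ (∀ f, P.ProgramOrder f e → f ∈ D) ∧ Enabled D e ∧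
      Executable (insert e D) τ

open Classical in
/-- The number of preemptions, computed recursively. -/
noncomputable def preemptions : List P.Event → ℕ
  | [] => 0
  | [_] => 0
  | a :: e :: τ => (if a.1 ≠ e.1 ∧ ¬ P.IsLast a then 1 else 0) + preemptions (e :: τ)

theorem preemptionAt_cons_succ (a : P.Event) (σ : List P.Event) (j : ℕ) :
    P.PreemptionAt (a :: σ) (j + 1) ↔ P.PreemptionAt σ j := by
  unfold PreemptionAt
  simp

theorem numPreemptions_cons (a : P.Event) (σ : List P.Event)
    [Decidable (P.PreemptionAt (a :: σ) 0)] :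
    P.numPreemptions (a :: σ) =
      (if P.PreemptionAt (a :: σ) 0 then 1 else 0) + P.numPreemptions σ := by
  classical
  unfold numPreemptions
  simp only [Finset.card_filter, List.length_cons, Finset.sum_range_succ', preemptionAt_cons_succ]
  rw [add_comm]
  congr!

theorem numPreemptions_eq (σ : List P.Event) : P.numPreemptions σ = preemptions σ := by
  classical
  induction σ with
  | nil => simp [numPreemptions, preemptions]
  | cons a σ ih =>
    rw [numPreemptions_cons, ih]
    cases σ with
    | nil =>
      have : ¬ P.PreemptionAt [a] 0 := fun ⟨h, _⟩ => by simp at h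
      simp [preemptions, this]
    | cons e τ => simp [preemptions, PreemptionAt]

theorem executable_append {D : Set P.Event} {σ τ : List P.Event} :
    Executable D (σ ++ τ) ↔ Executable D σ ∧ Executable (D ∪ {e | e ∈ σ}) τ := by
  induction σ generalizing D with
  | nil => simp [Executable]
  | cons a σ ih =>
    have : insert a D ∪ {e | e ∈ σ} = D ∪ {e | e ∈ a :: σ} := by
      ext e
      simp only [Set.mem_union, Set.mem_insert_iff, Set.mem_ofPred_eq, List.mem_cons]
      tauto
    simp only [List.cons_append, Executable, ih, this, and_assoc]

/-- The write that serves a read by position also serves it in the sense of `Holds`: a conflicting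
write of the prefix lies either after it, which consistency of the interleaving excludes, or before
it, and then it is not a successor in program order. -/
theorem executable_of_interleaving {σ : List P.Event}
    (hσ : P.IsInterleaving σ) (hc : P.SeqConsistent σ) (ρ τ : List P.Event) (h : σ = ρ ++ τ) :
    Executable {e | e ∈ ρ} τ := by
  obtain ⟨hnd, hall, hpw⟩ := hσ
  induction τ generalizing ρ with
  | nil => trivial
  | cons a τ ih =>
    have hlen : ρ.length < σ.length := by simp [h]
    have hget : σ.get ⟨ρ.length, hlen⟩ = a := by simp [h]
    refine ⟨?_, ?_, ?_, ?_⟩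
    · intro ha
      rw [h, List.nodup_append] at hnd
      exact hnd.2.2 a ha a (by simp) rfl
    · intro f hf
      have hfm := hall f
      rw [h, List.mem_append, List.mem_cons] at hfm
      rcases hfm with hfm | rfl | hfm
      · exact hfm
      · exact (lt_irrefl _ hf.2).elim
      · rw [h, List.pairwise_append, List.pairwise_cons] at hpw
        exact (hpw.2.1.1 f hfm hf).elim
    · intro x d hop
      obtain ⟨q, hq, hqw, hr⟩ := hc ⟨ρ.length, hlen⟩ x d (by rw [hget]; exact hop)
      have hq' : q.val < ρ.length := hq
      refine ⟨σ.get q, ?_, hqw, ?_⟩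
      · have : σ.get q = ρ[q.val] := by simp [h, List.getElem_append_left hq']
        rw [this]
        exact List.getElem_mem _
      · intro g hg d' hd hgw hpo
        obtain ⟨r, hrl, rfl⟩ := List.getElem_of_mem hg
        have hrσ : r < σ.length := by omega
        have hrg : σ.get ⟨r, hrσ⟩ = ρ[r] := by simp [h, List.getElem_append_left hrl]
        rcases lt_trichotomy q.val r with hqr | hqr | hqr
        · exact hr ⟨r, hrσ⟩ hqr hrl d' hd (by rw [hrg]; exact hgw)
        · subst hqr
          have : σ.get q = ρ[q.val] := hrg
          rw [this] at hpo
          exact lt_irrefl _ hpo.2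
        · have := List.pairwise_iff_get.1 hpw ⟨r, hrσ⟩ q hqr
          rw [hrg] at this
          exact this hpo
    · have := ih (ρ ++ [a]) (by simp [h])
      convert this using 1
      ext e
      simp [or_comm]

theorem Executable.pairwise {D : Set P.Event} {τ : List P.Event} (h : Executable D τ) :
    τ.Nodup ∧ (∀ e ∈ τ, e ∉ D) ∧ τ.Pairwise (fun e f => ¬ P.ProgramOrder f e) := by
  induction τ generalizing D with
  | nil => simp
  | cons a τ ih =>
    obtain ⟨h1, h2, -, h4⟩ := h
    obtain ⟨i1, i2, i3⟩ := ih h4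
    refine ⟨List.nodup_cons.2 ⟨fun ha => i2 a ha (Set.mem_insert _ _), i1⟩, ?_,
      List.pairwise_cons.2 ⟨?_, i3⟩⟩
    · intro e he
      rcases List.mem_cons.1 he with rfl | he
      · exact h1
      · exact fun h => i2 e he (Set.mem_insert_of_mem _ h)
    · exact fun e he hpo => i2 e he (Set.mem_insert_of_mem _ (h2 e hpo))

/-- Here one writer per variable is essential. A conflicting write positioned between the serving
write and the read belongs to the thread of the serving write; program order then agrees with
position, and `Holds` is contradicted. -/
theorem Executable.seqConsistent (hP : P.OneWriter) {σ : List P.Event}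
    (h : Executable (∅ : Set P.Event) σ) : P.SeqConsistent σ := by
  have hpw := h.pairwise.2.2
  intro p x d hop
  have hsplit : σ = σ.take p.val ++ σ.get p :: σ.drop (p.val + 1) := by
    simp
  have h' := h
  rw [hsplit, executable_append] at h'
  obtain ⟨f, hf, hfw, hg⟩ := h'.2.2.2.1 x d hop
  simp only [Set.empty_union, Set.mem_ofPred_eq] at hf hg
  obtain ⟨q, hq, rfl⟩ := List.getElem_of_mem hf
  have hq' : q < p.val ∧ q < σ.length := by
    rw [List.length_take] at hq
    omega
  simp only [List.getElem_take] at hfw hg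
  refine ⟨⟨q, hq'.2⟩, hq'.1, hfw, ?_⟩
  intro r hqr hrp d' hd hrw
  have hrm : σ.get r ∈ σ.take p.val := by
    rw [List.mem_take_iff_getElem]
    exact ⟨r.val, by have : r.val < p.val := hrp; omega, rfl⟩
  have h1 := hg _ hrm d' hd hrw
  have h2 := List.pairwise_iff_get.1 hpw ⟨q, hq'.2⟩ r hqr
  have ht := hP _ _ x d d' hfw hrw
  rcases lt_trichotomy (σ[q].2.val) ((σ.get r).2.val) with hlt | heq | hlt
  · exact h1 ⟨ht, hlt⟩
  · have := Event.ext_val ht heq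
    rw [this, hrw] at hfw
    cases hfw
    exact hd rfl
  · exact h2 ⟨ht.symm, hlt⟩

/-- Lets the final block of an execution count as a free one: a successor of `a` would have to be in
`D`, but then so would `a`. -/
theorem isLast_of_univ {D : Set P.Event} {a : P.Event} (ha : a ∉ D) (hD : DownClosed D)
    (h : D ∪ block D a = Set.univ) : P.IsLast a := by
  by_contra hl
  unfold IsLast at hl
  have := a.2.isLt
  let e : P.Event := ⟨a.1, ⟨a.2.val + 1, by omega⟩⟩
  have he : e ∈ D ∪ block D a := h ▸ trivial
  rw [mem_union_block] at he
  rcases he with he | ⟨-, he⟩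
  · exact ha (hD a e ⟨rfl, Nat.lt_succ_self _⟩ he)
  · exact absurd he (by simp [e])

theorem block_singleton {D : Set P.Event} {e : P.Event} (he : e ∉ D)
    (hpred : ∀ f, P.ProgramOrder f e → f ∈ D) : block D e = {e} := by
  ext f
  simp only [block, Set.mem_ofPred_eq, Set.mem_singleton_iff]
  constructor
  · rintro ⟨h1, h2, h3⟩
    rcases h3.lt_or_eq with h | h
    · exact (h1 (hpred f ⟨h2, h⟩)).elim
    · exact Event.ext_val h2 h
  · rintro rfl
    exact ⟨he, rfl, le_rfl⟩

theorem blockEnabled_singleton {D : Set P.Event} {e : P.Event} (he : e ∉ D)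
    (hpred : ∀ f, P.ProgramOrder f e → f ∈ D) (hen : Enabled D e) : BlockEnabled D e := by
  intro f hf
  rw [block_singleton he hpred] at hf ⊢
  obtain rfl : f = e := hf
  convert hen using 1
  ext g
  simp only [Set.mem_union, Set.mem_ofPred_eq, Set.mem_singleton_iff, or_iff_left_iff_imp]
  rintro ⟨rfl, h⟩
  exact (lt_irrefl _ h.2).elim

/-- An executable completion, started with a block that ends with `a`, splits into blocks. -/
theorem Executable.completable_of_block {τ : List P.Event} {D : Set P.Event} {a : P.Event} {m : ℕ}
    (ha : a ∉ D) (hD : DownClosed D) (hb : BlockEnabled D a) (hτ : Executable (D ∪ block D a) τ)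
    (hall : ∀ e, e ∈ D ∪ block D a ∨ e ∈ τ) (hm : preemptions (a :: τ) ≤ m) :
    Completable D m := by
  induction τ generalizing D a m with
  | nil =>
    have hu : D ∪ block D a = Set.univ :=
      Set.eq_univ_of_forall fun e => (hall e).resolve_right (by simp)
    refine .last a ha (isLast_of_univ ha hD hu) hb ?_
    rw [hu]
    exact .done _
  | cons e τ ih =>
    obtain ⟨h1, h2, h3, h4⟩ := hτ
    have hall' : ∀ f, f ∈ insert e (D ∪ block D a) ∨ f ∈ τ := by
      intro f
      have := hall f
      simp only [List.mem_cons] at this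
      simp only [Set.mem_insert_iff]
      tauto
    -- An event of the same thread extends the current block, which then ends with `e`. An event of
    -- another thread closes the block and opens the singleton block of `e`; closing is charged
    -- exactly if `a` is not last, as in `preemptions`.
    by_cases hea : e.1 = a.1
    · have hlt : a.2.val < e.2.val := by
        by_contra hlt
        exact h1 (mem_union_block.2 (.inr ⟨hea, not_lt.1 hlt⟩))
      have heD : e ∉ D := fun h => h1 (.inl h)
      have hblk : block D e = insert e (block D a) := by
        ext f
        simp only [Set.mem_insert_iff]
        constructor
        · rintro ⟨g1, g2, g3⟩
          rcases g3.lt_or_eq with h | h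
          · exact .inr ((h2 f ⟨g2, h⟩).resolve_left g1)
          · exact .inl (Event.ext_val g2 h)
        · rintro (rfl | ⟨g1, g2, g3⟩)
          · exact ⟨heD, rfl, le_rfl⟩
          · exact ⟨g1, g2.trans hea.symm, by omega⟩
      have hun : D ∪ block D e = insert e (D ∪ block D a) := by
        rw [hblk, Set.union_insert]
      have hbe : BlockEnabled D e := by
        intro f hf
        by_cases hfe : f = e
        · subst hfe
          convert h3 using 1
          ext g
          rw [hblk]
          simp only [Set.mem_union, Set.mem_ofPred_eq, Set.mem_insert_iff]
          constructor
          · rintro (h | ⟨rfl | h, h'⟩)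
            · exact .inl h
            · exact (lt_irrefl _ h'.2).elim
            · exact .inr h
          · rintro (h | h)
            · exact .inl h
            · exact .inr ⟨.inr h, h.2.1.trans hea.symm, h.2.2.trans_lt hlt⟩
        · have hfa : f ∈ block D a := by
            rw [hblk] at hf
            exact hf.resolve_left hfe
          convert hb f hfa using 1
          ext g
          rw [hblk]
          simp only [Set.mem_union, Set.mem_ofPred_eq, Set.mem_insert_iff]
          have : g = e → ¬ P.ProgramOrder g f := by
            rintro rfl h
            have := h.2
            have := hfa.2.2
            omega
          tauto
      refine ih heD hD hbe (hun ▸ h4) (fun f => by rw [hun]; exact hall' f) ?_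
      exact le_trans (by simp [preemptions]) hm
    · have hD' := downClosed_union_block hD a
      have hbs := block_singleton h1 h2
      have hun : D ∪ block D a ∪ block (D ∪ block D a) e = insert e (D ∪ block D a) := by
        rw [hbs, Set.union_singleton]
      have key : ∀ q, preemptions (e :: τ) ≤ q → Completable (D ∪ block D a) q := fun q hq =>
        ih h1 hD' (blockEnabled_singleton h1 h2 h3) (hun ▸ h4)
          (fun f => by rw [hun]; exact hall' f) hq
      by_cases hl : P.IsLast a
      · refine .last a ha hl hb (key m ?_)
        exact le_trans (by simp [preemptions]) hm
      · have : (a.1 ≠ e.1 ∧ ¬ P.IsLast a) := ⟨fun h => hea h.symm, hl⟩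
        rw [preemptions, if_pos this] at hm
        obtain ⟨q, rfl⟩ : ∃ q, m = q + 1 := ⟨m - 1, by omega⟩
        exact .preempt a ha hb (key q (by omega))

theorem VSC.completable {b : ℕ} (h : P.VSC b) : Completable (∅ : Set P.Event) b := by
  obtain ⟨σ, hσ, hc, hb⟩ := h
  have hex := executable_of_interleaving hσ hc [] σ rfl
  have hemp : {e : P.Event | e ∈ ([] : List P.Event)} = ∅ := by ext; simp
  rw [hemp] at hex
  rw [numPreemptions_eq] at hb
  cases σ with
  | nil =>
    have : (∅ : Set P.Event) = Set.univ := Set.eq_univ_of_forall fun e => by simpa using hσ.2.1 e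
    rw [this]
    exact .done _
  | cons e τ =>
    obtain ⟨h1, h2, h3, h4⟩ := hex
    have hun : (∅ : Set P.Event) ∪ block ∅ e = insert e ∅ := by
      rw [block_singleton h1 h2, Set.union_singleton]
    refine Executable.completable_of_block h1 downClosed_empty (blockEnabled_singleton h1 h2 h3)
      (hun ▸ h4) (fun f => ?_) hb
    rw [hun]
    simpa using hσ.2.1 f

/-- The events of an enabled block, in program order. -/
theorem exists_executable_block {D : Set P.Event} (hD : DownClosed D) {a : P.Event}
    (hb : BlockEnabled D a) (k : ℕ) (e : P.Event) (he : e ∈ block D a) (hk : e.2.val = k) :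
    ∃ β, Executable D (β ++ [e]) ∧ (∀ f, f ∈ β ++ [e] ↔ f ∈ block D e) := by
  induction k generalizing e with
  | zero =>
    have hpred : ∀ f, P.ProgramOrder f e → f ∈ D := fun f hf => by
      have := hf.2
      omega
    refine ⟨[], ⟨he.1, hpred, ?_, trivial⟩, fun f => ?_⟩
    · convert hb e he using 1
      ext g
      simp only [Set.mem_union, Set.mem_ofPred_eq]
      have := hpred g
      tauto
    · rw [block_singleton he.1 hpred]
      simp
  | succ k ih =>
    let e' : P.Event := ⟨e.1, ⟨k, by have := e.2.isLt; omega⟩⟩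
    have hpo : P.ProgramOrder e' e := ⟨rfl, by simp [e', hk]⟩
    -- If the immediate predecessor is already executed, `e` is the first event of the block;
    -- otherwise the induction hypothesis executes the block up to `e'`.
    by_cases he' : e' ∈ D
    · have hpred : ∀ f, P.ProgramOrder f e → f ∈ D := by
        rintro f ⟨h1, h2⟩
        rcases (show f.2.val ≤ k by omega).lt_or_eq with h | h
        · exact hD f e' ⟨h1, h⟩ he'
        · rwa [show f = e' from Event.ext_val h1 h]
      refine ⟨[], ⟨he.1, hpred, ?_, trivial⟩, fun f => ?_⟩
      · convert hb e he using 1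
        ext g
        simp only [Set.mem_union, Set.mem_ofPred_eq]
        have := hpred g
        tauto
      · rw [block_singleton he.1 hpred]
        simp
    · have hke : k ≤ a.2.val := by
        have := he.2.2
        omega
      obtain ⟨β, hβ, hβm⟩ := ih e' ⟨he', he.2.1, hke⟩ rfl
      have hun : D ∪ {f | f ∈ β ++ [e']} = D ∪ {f | f ∈ block D a ∧ P.ProgramOrder f e} := by
        ext f
        simp only [Set.mem_union, Set.mem_ofPred_eq, hβm]
        constructor
        · rintro (h | ⟨h1, h2, h3⟩)
          · exact .inl h
          · have h3 : f.2.val ≤ k := h3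
            exact .inr ⟨⟨h1, h2.trans he.2.1, by omega⟩, h2, by omega⟩
        · rintro (h | ⟨h1, h2⟩)
          · exact .inl h
          · have h3 := h2.2
            exact .inr ⟨h1.1, h2.1, show f.2.val ≤ k by omega⟩
      refine ⟨β ++ [e'], executable_append.2 ⟨hβ, ?_, ?_, ?_, trivial⟩, fun f => ?_⟩
      · rw [hun]
        rintro (h | ⟨-, h⟩)
        · exact he.1 h
        · exact lt_irrefl _ h.2
      · intro f hf
        rw [hun]
        by_cases hfD : f ∈ D
        · exact .inl hfD
        · exact .inr ⟨⟨hfD, hf.1.trans he.2.1, hf.2.le.trans he.2.2⟩, hf⟩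
      · rw [hun]
        exact hb e he
      · rw [List.mem_append, hβm, List.mem_singleton]
        constructor
        · rintro (⟨h1, h2, h3⟩ | rfl)
          · have h3 : f.2.val ≤ k := h3
            exact ⟨h1, h2, by omega⟩
          · exact ⟨he.1, rfl, le_rfl⟩
        · rintro ⟨h1, h2, h3⟩
          rcases h3.lt_or_eq with h | h
          · exact .inl ⟨h1, h2, show f.2.val ≤ k by omega⟩
          · exact .inr (Event.ext_val h2 h)

theorem preemptions_cons_le (a : P.Event) (τ : List P.Event) :
    preemptions (a :: τ) ≤ preemptions τ + 1 ∧
      (P.IsLast a → preemptions (a :: τ) ≤ preemptions τ) := by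
  cases τ with
  | nil => simp [preemptions]
  | cons e τ =>
    rw [preemptions]
    constructor
    · split_ifs <;> omega
    · intro h
      simp [h]

theorem preemptions_append_cons (β : List P.Event) (a : P.Event) (τ : List P.Event)
    (h : ∀ e ∈ β, e.1 = a.1) : preemptions (β ++ a :: τ) = preemptions (a :: τ) := by
  induction β with
  | nil => rfl
  | cons e β ih =>
    have ih' := ih fun f hf => h f (List.mem_cons_of_mem _ hf)
    rw [← ih']
    have he := h e (by simp)
    cases β with
    | nil => simp [preemptions, he]
    | cons f β =>
      have hf := h f (by simp)
      simp [preemptions, he, hf]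

theorem exists_executable_of_block {D : Set P.Event} (hD : DownClosed D) {a : P.Event}
    (ha : a ∉ D) (hb : BlockEnabled D a) {τ : List P.Event} (hτ : Executable (D ∪ block D a) τ)
    (hall : ∀ e, e ∈ D ∪ block D a ∨ e ∈ τ) :
    ∃ τ', Executable D τ' ∧ (∀ e, e ∈ D ∨ e ∈ τ') ∧ preemptions τ' = preemptions (a :: τ) := by
  obtain ⟨β, h1, h2⟩ := exists_executable_block hD hb _ a ⟨ha, rfl, le_rfl⟩ rfl
  refine ⟨β ++ [a] ++ τ, executable_append.2 ⟨h1, ?_⟩, fun e => ?_, ?_⟩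
  · convert hτ using 2
    ext f
    exact h2 f
  · rw [List.mem_append, h2, ← or_assoc]
    exact hall e
  · rw [List.append_assoc]
    refine preemptions_append_cons β a τ fun e he => ?_
    exact ((h2 e).1 (by simp [he])).2.1

/-- Concatenate the blocks. Only an inequality is available: neighbouring blocks may belong to the
same thread, and a charged block may end its thread, so some charges correspond to no preemption. -/
theorem Completable.exists_executable {D : Set P.Event} {m : ℕ} (h : Completable D m)
    (hD : DownClosed D) :
    ∃ τ, Executable D τ ∧ (∀ e, e ∈ D ∨ e ∈ τ) ∧ preemptions τ ≤ m := by
  induction h with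
  | done m => exact ⟨[], trivial, fun e => .inl trivial, by simp [preemptions]⟩
  | last a ha hl hb _ ih =>
    obtain ⟨τ, h1, h2, h3⟩ := ih (downClosed_union_block hD a)
    obtain ⟨τ', g1, g2, g3⟩ := exists_executable_of_block hD ha hb h1 h2
    exact ⟨τ', g1, g2, g3 ▸ ((preemptions_cons_le a τ).2 hl).trans h3⟩
  | preempt a ha hb _ ih =>
    obtain ⟨τ, h1, h2, h3⟩ := ih (downClosed_union_block hD a)
    obtain ⟨τ', g1, g2, g3⟩ := exists_executable_of_block hD ha hb h1 h2
    exact ⟨τ', g1, g2, g3 ▸ (preemptions_cons_le a τ).1.trans (Nat.succ_le_succ h3)⟩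

theorem vsc_iff_completable (hP : P.OneWriter) {b : ℕ} :
    P.VSC b ↔ Completable (∅ : Set P.Event) b := by
  refine ⟨VSC.completable, fun h => ?_⟩
  obtain ⟨σ, h1, h2, h3⟩ := h.exists_executable downClosed_empty
  refine ⟨σ, ⟨h1.pairwise.1, fun e => by simpa using h2 e, h1.pairwise.2.2⟩,
    h1.seqConsistent hP, ?_⟩
  rwa [numPreemptions_eq]

/-! ### Saturation -/

/-- The position of an event in the concatenation of all threads. -/
def index (e : P.Event) : ℕ := ((P.threads.take e.1.val).map List.length).sum + e.2.val

theorem index_lt_of_programOrder {e f : P.Event} (h : P.ProgramOrder e f) : index e < index f := by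
  have h1 : e.1.val = f.1.val := congrArg Fin.val h.1
  have := h.2
  simp only [index, h1]
  omega

/-- The last event of the runnable thread that comes last. -/
def IsPick (D : Set P.Event) (a : P.Event) : Prop :=
  Runnable D a.1 ∧ ∀ e : P.Event, Runnable D e.1 → index e ≤ index a

/-- Maximality is over all events of runnable threads, which matches a scan that overwrites its
choice at every such event; a successor of `a` in its thread would beat it. -/
theorem IsPick.isLast {D : Set P.Event} {a : P.Event} (h : IsPick D a) : P.IsLast a := by
  by_contra hl
  unfold IsLast at hl
  have := a.2.isLt
  let e : P.Event := ⟨a.1, ⟨a.2.val + 1, by omega⟩⟩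
  have h1 := h.2 e h.1
  have h2 : index a < index e := index_lt_of_programOrder ⟨rfl, Nat.lt_succ_self _⟩
  omega

/-- Run the picked thread to its end. -/
def runPicked (D : Set P.Event) : Set P.Event := D ∪ {e | ∃ a, IsPick D a ∧ e ∈ block D a}

theorem runPicked_of_stuck {D : Set P.Event} (h : ∀ i, ¬ Runnable D i) : runPicked D = D := by
  ext e
  simp only [runPicked, Set.mem_union, Set.mem_ofPred_eq, or_iff_left_iff_imp]
  rintro ⟨a, ha, -⟩
  exact (h _ ha.1).elim

/-- The operations of all threads, each with the label of its thread; labels start with `l`. -/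
def labelled : ℕ → List (List MemOp) → List (ℕ × MemOp)
  | _, [] => []
  | l, S :: Ts => S.map (fun o => (l, o)) ++ labelled (l + 1) Ts

theorem labelled_getElem? (l : ℕ) (Ts : List (List MemOp)) (i : Fin Ts.length)
    (p : Fin (Ts.get i).length) :
    (labelled l Ts)[((Ts.take i.val).map List.length).sum + p.val]? =
      some (l + i.val, (Ts.get i).get p) := by
  induction Ts generalizing l with
  | nil => exact i.elim0
  | cons S Ts ih =>
    obtain ⟨i, hi⟩ := i
    cases i with
    | zero =>
      have hp : p.val < S.length := p.isLt
      simp only [labelled, List.take_zero, List.map_nil, List.sum_nil, zero_add, add_zero]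
      rw [List.getElem?_append_left (by simpa using hp), List.getElem?_map,
        List.getElem?_eq_getElem hp]
      rfl
    | succ i =>
      have hi' : i < Ts.length := by simpa using hi
      have := ih (l + 1) ⟨i, hi'⟩ p
      simp only [labelled, List.take_succ_cons, List.map_cons, List.sum_cons]
      rw [List.getElem?_append_right (by rw [List.length_map]; omega), List.length_map,
        show S.length + ((Ts.take i).map List.length).sum + p.val - S.length =
          ((Ts.take i).map List.length).sum + p.val by omega, this]
      simp only [Option.some.injEq, Prod.mk.injEq]
      exact ⟨by omega, rfl⟩

theorem length_labelled (l : ℕ) (Ts : List (List MemOp)) :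
    (labelled l Ts).length = (Ts.map List.length).sum := by
  induction Ts generalizing l with
  | nil => rfl
  | cons S Ts ih => simp [labelled, ih]

theorem exists_index_aux (Ts : List (List MemOp)) (j : ℕ) (hj : j < (Ts.map List.length).sum) :
    ∃ (i : Fin Ts.length) (p : Fin (Ts.get i).length),
      ((Ts.take i.val).map List.length).sum + p.val = j := by
  induction Ts generalizing j with
  | nil => simp at hj
  | cons S Ts ih =>
    by_cases h : j < S.length
    · exact ⟨⟨0, by simp⟩, ⟨j, h⟩, by simp⟩
    · simp only [List.map_cons, List.sum_cons] at hj
      obtain ⟨i, p, hip⟩ := ih (j - S.length) (by omega)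
      refine ⟨i.succ, p, ?_⟩
      simp only [Fin.val_succ, List.take_succ_cons, List.map_cons, List.sum_cons]
      omega

theorem labelled_index (e : P.Event) :
    (labelled 1 P.threads)[index e]? = some (e.1.val + 1, P.op e) := by
  rw [add_comm]
  exact labelled_getElem? 1 P.threads e.1 e.2

theorem exists_index_eq {j : ℕ} (hj : j < P.numEvents) : ∃ e : P.Event, index e = j := by
  obtain ⟨i, p, h⟩ := exists_index_aux P.threads j hj
  exact ⟨⟨i, p⟩, h⟩

theorem index_lt (e : P.Event) : index e < P.numEvents := by
  have h := labelled_index e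
  rw [List.getElem?_eq_some_iff] at h
  obtain ⟨h, -⟩ := h
  rwa [length_labelled] at h

/-- The entry of `labelled` at the index gives back the thread; then the offset within the thread is
determined too. -/
theorem index_injective : Function.Injective (index (P := P)) := by
  intro e f h
  have h1 := labelled_index e
  rw [h, labelled_index f] at h1
  simp only [Option.some.injEq, Prod.mk.injEq, add_left_inj] at h1
  have ht : f.1 = e.1 := Fin.ext h1.1
  refine Event.ext_val ht.symm ?_
  unfold index at h
  rw [h1.1] at h
  omega

theorem IsPick.unique {D : Set P.Event} {a a' : P.Event} (h : IsPick D a) (h' : IsPick D a') :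
    a = a' :=
  index_injective (le_antisymm (h'.2 a h.1) (h.2 a' h'.1))

theorem IsPick.runPicked_eq {D : Set P.Event} {a : P.Event} (h : IsPick D a) :
    runPicked D = D ∪ block D a := by
  ext e
  simp only [runPicked, Set.mem_union, Set.mem_ofPred_eq]
  constructor
  · rintro (he | ⟨a', h', he⟩)
    · exact .inl he
    · exact .inr (h.unique h' ▸ he)
  · rintro (he | he)
    · exact .inl he
    · exact .inr ⟨a, h, he⟩

theorem exists_event (i : Fin P.threads.length) : ∃ e : P.Event, e.1 = i :=
  ⟨⟨i, ⟨0, List.length_pos_of_ne_nil (P.thread_ne _ (List.get_mem _ _))⟩⟩, rfl⟩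

theorem exists_isPick {D : Set P.Event} {i : Fin P.threads.length} (h : Runnable D i) :
    ∃ a, IsPick D a := by
  obtain ⟨e, rfl⟩ := exists_event i
  obtain ⟨a, ha, hmax⟩ := Set.exists_max_image {e : P.Event | Runnable D e.1} index
    (Set.toFinite _) ⟨e, h⟩
  exact ⟨a, ha, hmax⟩

theorem downClosed_runPicked {D : Set P.Event} (hD : DownClosed D) : DownClosed (runPicked D) := by
  by_cases h : ∃ i, Runnable D i
  · obtain ⟨i, hi⟩ := h
    obtain ⟨a, ha⟩ := exists_isPick hi
    rw [ha.runPicked_eq]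
    exact downClosed_union_block hD a
  · rw [runPicked_of_stuck (not_exists.1 h)]
    exact hD

theorem downClosed_iterate_runPicked {D : Set P.Event} (hD : DownClosed D) (q : ℕ) :
    DownClosed (runPicked^[q] D) := by
  induction q with
  | zero => exact hD
  | succ q ih => rw [Function.iterate_succ_apply']; exact downClosed_runPicked ih

/-- After as many rounds as there are threads, no thread is runnable. -/
theorem stuck_iterate_runPicked (D : Set P.Event) (i : Fin P.threads.length) :
    ¬ Runnable (runPicked^[P.numThreads] D) i := by
  classical
  -- Induction on a bound for the number of unfinished threads: a round with a runnable thread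
  -- finishes one of them, and a round without one is a fixed point of `runPicked`.
  suffices h : ∀ q (D : Set P.Event),
      (Finset.univ.filter fun i : Fin P.threads.length => ∃ e, e ∉ D ∧ e.1 = i).card ≤ q →
      ∀ i, ¬ Runnable (runPicked^[q] D) i from
    h _ D ((Finset.card_filter_le _ _).trans (by simp [numThreads])) i
  intro q
  induction q with
  | zero =>
    intro D hq i hi
    have : i ∈ (Finset.univ.filter fun i : Fin P.threads.length => ∃ e, e ∉ D ∧ e.1 = i) := by
      simpa using hi.1
    rw [Finset.card_eq_zero.1 (Nat.le_zero.1 hq)] at this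
    simp at this
  | succ q ih =>
    intro D hq
    by_cases h : ∃ i, Runnable D i
    · obtain ⟨i, hi⟩ := h
      obtain ⟨a, ha⟩ := exists_isPick hi
      rw [Function.iterate_succ_apply]
      refine ih _ (Nat.le_of_lt_succ (lt_of_lt_of_le (Finset.card_lt_card ?_) hq))
      rw [ha.runPicked_eq, union_block_last ha.isLast]
      refine (Finset.ssubset_iff_of_subset ?_).2 ⟨a.1, ?_, ?_⟩
      · intro j
        simp only [Finset.mem_filter, Finset.mem_univ, true_and]
        rintro ⟨e, he, hj⟩
        exact ⟨e, fun h => he (.inl h), hj⟩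
      · simpa using ha.1.1
      · simp only [Finset.mem_filter, Finset.mem_univ, true_and, not_exists, not_and]
        exact fun e he hea => he (.inr hea)
    · rw [Function.iterate_fixed (runPicked_of_stuck (not_exists.1 h))]
      exact not_exists.1 h

end ConcProg

namespace RAM

/-! ### A language with tables and bounded loops, compiled to the machine -/

/-- A state with registers, sixteen tables and a read-only input of length `base`. -/
structure TState where
  reg : ℕ → ℕ
  tab : Fin 16 → ℕ → ℕ
  inp : ℕ → ℕ
  base : ℕ

namespace TState

def setReg (h : TState) (r v : ℕ) : TState := { h with reg := Function.update h.reg r v }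

def setTab (h : TState) (t : Fin 16) (i v : ℕ) : TState :=
  { h with tab := Function.update h.tab t (Function.update (h.tab t) i v) }

/-- The content of the memory cell `a`: the tables are interleaved after the input. -/
def cell (h : TState) (a : ℕ) : ℕ :=
  if a < h.base then h.inp a else
    h.tab ⟨(a - h.base) % 16, Nat.mod_lt _ (by decide)⟩ ((a - h.base) / 16)

end TState

inductive Cmd where
  | skip
  | const (r c : ℕ)
  | move (r s : ℕ)
  | add (r s t : ℕ)
  | sub (r s t : ℕ)
  /-- `reg r :=` memory cell `reg i` -/
  | raw (r i : ℕ)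
  /-- `reg r := tab t (reg i)` -/
  | get (r : ℕ) (t : Fin 16) (i : ℕ)
  /-- `tab t (reg i) := reg r` -/
  | put (t : Fin 16) (i r : ℕ)
  | seq (A B : Cmd)
  | cond (r : ℕ) (A B : Cmd)
  /-- repeat `A` as many times as register `m` says, counting in register `j` from `0` -/
  | rep (m j : ℕ) (A : Cmd)

namespace Cmd

/-- The iteration count of `rep` is read on entry, so every command terminates and the semantics is
a total function. -/
def run : Cmd → TState → TState
  | skip, h => h
  | const r c, h => h.setReg r c
  | move r u, h => h.setReg r (h.reg u)
  | add r u v, h => h.setReg r (h.reg u + h.reg v)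
  | sub r u v, h => h.setReg r (h.reg u - h.reg v)
  | raw r i, h => h.setReg r (h.cell (h.reg i))
  | get r t i, h => h.setReg r (h.tab t (h.reg i))
  | put t i r, h => h.setTab t (h.reg i) (h.reg r)
  | seq A B, h => B.run (A.run h)
  | cond r A B, h => if h.reg r ≠ 0 then A.run h else B.run h
  | rep m j A, h =>
    (fun g => (A.run g).setReg j ((A.run g).reg j + 1))^[h.reg m] (h.setReg j 0)

/-- One iteration of a loop. -/
def iter (j : ℕ) (A : Cmd) (g : TState) : TState := (A.run g).setReg j ((A.run g).reg j + 1)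

/-- These are the exact step counts of the compiled code. A table access takes seven steps for the
address and one for the memory. An iteration adds a test, the increment of the visible counter and
the decrement of the hidden one; a loop adds two initialisations and the last test. -/
def cost : Cmd → TState → ℕ
  | skip, _ | const _ _, _ | move _ _, _ | add _ _ _, _ | sub _ _ _, _ | raw _ _, _ => 1
  | get _ _ _, _ | put _ _ _, _ => 8
  | seq A B, h => A.cost h + B.cost (A.run h)
  | cond r A B, h => if h.reg r ≠ 0 then A.cost h + 1 else B.cost h + 1
  | rep m j A, h => 3 + ∑ i ∈ Finset.range (h.reg m), (A.cost ((iter j A)^[i] (h.setReg j 0)) + 3)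

theorem run_rep (m j : ℕ) (A : Cmd) (h : TState) :
    (rep m j A).run h = (iter j A)^[h.reg m] (h.setReg j 0) := rfl

/-- Put the address of cell `reg i` of table `t` into register `3`. -/
def addr (t : Fin 16) (i : ℕ) : Prog :=
  .seq (.add 3 (2 * i) (2 * i)) (.seq (.add 3 3 3) (.seq (.add 3 3 3) (.seq (.add 3 3 3)
    (.seq (.add 3 3 7) (.seq (.const 5 t) (.add 3 3 5))))))

/-- Registers of the table language are the even ones; `1` holds one, `3` and `5` are scratch, `7`
holds the base, and `2 * d + 9` is the counter of the loops at depth `d`. -/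
def compile : ℕ → Cmd → Prog
  | _, skip => .skip
  | _, const r c => .const (2 * r) c
  | _, move r u => .move (2 * r) (2 * u)
  | _, add r u v => .add (2 * r) (2 * u) (2 * v)
  | _, sub r u v => .sub (2 * r) (2 * u) (2 * v)
  | _, raw r i => .load (2 * r) (2 * i)
  | _, get r t i => .seq (addr t i) (.load (2 * r) 3)
  | _, put t i r => .seq (addr t i) (.store 3 (2 * r))
  | d, seq A B => .seq (A.compile d) (B.compile d)
  | d, cond r A B => .cond (2 * r) (A.compile d) (B.compile d)
  | d, rep m j A => .seq (.move (2 * d + 9) (2 * m)) (.seq (.const (2 * j) 0)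
      (.loop (2 * d + 9) (.seq (A.compile (d + 1))
        (.seq (.add (2 * j) (2 * j) 1) (.sub (2 * d + 9) (2 * d + 9) 1)))))

end Cmd

/-- The machine state `s` represents `h`. -/
structure Represents (h : TState) (s : State) : Prop where
  reg : ∀ r, s.reg (2 * r) = h.reg r
  one : s.reg 1 = 1
  base : s.reg 7 = h.base
  tab : ∀ t i, s.mem (h.base + 16 * i + t.val) = h.tab t i
  inp : ∀ a, a < h.base → s.mem a = h.inp a

theorem Represents.cell {h : TState} {s : State} (hs : Represents h s) (a : ℕ) :
    s.mem a = h.cell a := by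
  unfold TState.cell
  split_ifs with ha
  · exact hs.inp a ha
  · rw [← hs.tab]
    congr 1
    simp only
    omega

theorem Represents.setReg {h : TState} {s : State} (hs : Represents h s) (r v : ℕ) :
    Represents (h.setReg r v) (s.setReg (2 * r) v) where
  reg q := by
    simp only [State.setReg, TState.setReg, Function.update_apply]
    by_cases hq : q = r
    · simp [hq]
    · rw [if_neg (by omega), if_neg hq, hs.reg]
  one := by
    simp only [State.setReg, Function.update_apply]
    rw [if_neg (by omega), hs.one]
  base := by
    simp only [State.setReg, TState.setReg, Function.update_apply]
    rw [if_neg (by omega), hs.base]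
  tab := hs.tab
  inp := hs.inp

theorem Represents.setReg_hidden {h : TState} {s : State} (hs : Represents h s) {r : ℕ} (v : ℕ)
    (hr : r % 2 = 1) (h1 : r ≠ 1) (h7 : r ≠ 7) : Represents h (s.setReg r v) where
  reg q := by
    simp only [State.setReg, Function.update_apply]
    rw [if_neg (by omega), hs.reg]
  one := by
    simp only [State.setReg, Function.update_apply]
    rw [if_neg (by omega), hs.one]
  base := by
    simp only [State.setReg, Function.update_apply]
    rw [if_neg (by omega), hs.base]
  tab := hs.tab
  inp := hs.inp

theorem Represents.setMem {h : TState} {s : State} (hs : Represents h s) (t : Fin 16) (i v : ℕ) :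
    Represents (h.setTab t i v) (s.setMem (h.base + 16 * i + t.val) v) where
  reg := hs.reg
  one := hs.one
  base := hs.base
  tab u k := by
    have := t.isLt
    have := u.isLt
    simp only [State.setMem, TState.setTab, Function.update_apply]
    by_cases hu : u = t
    · subst hu
      by_cases hk : k = i
      · simp [hk]
      · rw [if_neg (by omega), if_pos rfl, Function.update_of_ne hk, hs.tab]
    · have : u.val ≠ t.val := fun h => hu (Fin.ext h)
      rw [if_neg (by omega), if_neg hu, hs.tab]
  inp a ha := by
    simp only [State.setMem, TState.setTab, Function.update_apply] at ha ⊢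
    rw [if_neg (by omega), hs.inp a ha]

/-- Four doublings replace a multiplication by sixteen. Only the scratch registers `3` and `5`
change, so the hidden loop counters, from `9` on, survive. -/
theorem exec_addr {h : TState} {s : State} (hs : Represents h s) (t : Fin 16) (i : ℕ) :
    ∃ s', Exec (Cmd.addr t i) s s' 7 ∧ Represents h s' ∧
      s'.reg 3 = h.base + 16 * h.reg i + t.val ∧ ∀ r, 9 ≤ r → s'.reg r = s.reg r := by
  refine ⟨_, .seq (.add _ _ _ _) (.seq (.add _ _ _ _) (.seq (.add _ _ _ _) (.seq (.add _ _ _ _)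
    (.seq (.add _ _ _ _) (.seq (.const _ _ _) (.add _ _ _ _)))))), ?_, ?_, ?_⟩
  · repeat' first
      | exact hs
      | refine Represents.setReg_hidden ?_ _ (by decide) (by decide) (by decide)
  · simp only [State.setReg, Function.update_apply, hs.reg, hs.base]
    simp
    omega
  · intro r hr
    have h3 : r ≠ 3 := by omega
    have h5 : r ≠ 5 := by omega
    simp [State.setReg, h3, h5]

/-- The last clause makes the induction work for nested loops: code compiled at depth `d` leaves the
hidden counters of all enclosing loops alone. -/
theorem exec_compile (c : Cmd) : ∀ (d : ℕ) (h : TState) (s : State), Represents h s →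
    ∃ s', Exec (c.compile d) s s' (c.cost h) ∧ Represents (c.run h) s' ∧
      ∀ q, q < d → s'.reg (2 * q + 9) = s.reg (2 * q + 9) := by
  have hid : ∀ (s : State) (r v q : ℕ),
      (s.setReg (2 * r) v).reg (2 * q + 9) = s.reg (2 * q + 9) := by
    intro s r v q
    simp only [State.setReg, Function.update_apply]
    rw [if_neg (by omega)]
  induction c with
  | skip => exact fun d h s hs => ⟨s, .skip s, hs, fun _ _ => rfl⟩
  | const r c => exact fun d h s hs => ⟨_, .const s _ _, hs.setReg r c, fun q _ => hid _ _ _ q⟩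
  | move r u =>
    intro d h s hs
    refine ⟨_, .move s _ _, ?_, fun q _ => hid _ _ _ q⟩
    rw [hs.reg]
    exact hs.setReg r _
  | add r u v =>
    intro d h s hs
    refine ⟨_, .add s _ _ _, ?_, fun q _ => hid _ _ _ q⟩
    rw [hs.reg, hs.reg]
    exact hs.setReg r _
  | sub r u v =>
    intro d h s hs
    refine ⟨_, .sub s _ _ _, ?_, fun q _ => hid _ _ _ q⟩
    rw [hs.reg, hs.reg]
    exact hs.setReg r _
  | raw r i =>
    intro d h s hs
    refine ⟨_, .load s _ _, ?_, fun q _ => hid _ _ _ q⟩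
    rw [hs.reg, hs.cell]
    exact hs.setReg r _
  | get r t i =>
    intro d h s hs
    obtain ⟨s', h1, h2, h3, h4⟩ := exec_addr hs t i
    refine ⟨_, .seq h1 (.load s' _ _), ?_, fun q _ => (hid _ _ _ q).trans (h4 _ (by omega))⟩
    rw [h3, h2.tab]
    exact h2.setReg r _
  | put t i r =>
    intro d h s hs
    obtain ⟨s', h1, h2, h3, h4⟩ := exec_addr hs t i
    refine ⟨_, .seq h1 (.store s' _ _), ?_, fun q _ => h4 _ (by omega)⟩
    rw [h3, h2.reg]
    exact h2.setMem t _ _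
  | seq A B ihA ihB =>
    intro d h s hs
    obtain ⟨s', h1, h2, h3⟩ := ihA d h s hs
    obtain ⟨s'', g1, g2, g3⟩ := ihB d _ s' h2
    exact ⟨s'', .seq h1 g1, g2, fun q hq => (g3 q hq).trans (h3 q hq)⟩
  | cond r A B ihA ihB =>
    intro d h s hs
    by_cases hr : h.reg r = 0
    · obtain ⟨s', h1, h2, h3⟩ := ihB d h s hs
      refine ⟨s', ?_, by simpa [Cmd.run, hr] using h2, h3⟩
      simpa [Cmd.cost, Cmd.compile, hr] using Exec.cond_false (by rw [hs.reg, hr]) h1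
    · obtain ⟨s', h1, h2, h3⟩ := ihA d h s hs
      refine ⟨s', ?_, by simpa [Cmd.run, hr] using h2, h3⟩
      simpa [Cmd.cost, Cmd.compile, hr] using Exec.cond_true (by rwa [hs.reg]) h1
  | rep m j A ih =>
    intro d h s hs
    -- Induction on the value of the hidden counter; the visible counter `j` plays no part in
    -- deciding when the loop stops.
    have loop : ∀ (k : ℕ) (g : TState) (s : State), Represents g s → s.reg (2 * d + 9) = k →
        ∃ s', Exec (.loop (2 * d + 9) (.seq (A.compile (d + 1))
            (.seq (.add (2 * j) (2 * j) 1) (.sub (2 * d + 9) (2 * d + 9) 1)))) s s'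
            (1 + ∑ i ∈ Finset.range k, (A.cost ((Cmd.iter j A)^[i] g) + 3)) ∧
          Represents ((Cmd.iter j A)^[k] g) s' ∧
          ∀ q, q < d → s'.reg (2 * q + 9) = s.reg (2 * q + 9) := by
      intro k
      induction k with
      | zero => exact fun g s hs hk => ⟨s, .loop_done hk, hs, fun _ _ => rfl⟩
      | succ k ihk =>
        intro g s hs hk
        obtain ⟨s₁, h1, h2, h3⟩ := ih (d + 1) g s hs
        have hs₂ : Represents (Cmd.iter j A g)
            (s₁.setReg (2 * j) (s₁.reg (2 * j) + s₁.reg 1)) := by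
          rw [h2.one, h2.reg]
          exact h2.setReg j _
        obtain ⟨s₃, g1, g2, g3⟩ := ihk (Cmd.iter j A g) _
          (hs₂.setReg_hidden (r := 2 * d + 9) k (by omega) (by omega) (by omega))
          (by simp [State.setReg])
        refine ⟨s₃, ?_, g2, ?_⟩
        · have hsub := Exec.sub (s₁.setReg (2 * j) (s₁.reg (2 * j) + s₁.reg 1))
            (2 * d + 9) (2 * d + 9) 1
          rw [hs₂.one, hid, h3 d (by omega), hk, Nat.add_sub_cancel] at hsub
          have := Exec.loop_step (r := 2 * d + 9) (by omega)
            (h1.seq ((Exec.add s₁ (2 * j) (2 * j) 1).seq hsub)) g1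
          rw [Finset.sum_range_succ']
          convert this using 1
          simp only [Function.iterate_succ_apply, Function.iterate_zero, id]
          omega
        · intro q hq
          rw [g3 q hq, ← h3 q (by omega), ← hid s₁ j (s₁.reg (2 * j) + s₁.reg 1) q]
          simp only [State.setReg]
          rw [Function.update_of_ne (by omega)]
    have hs₁ := (hs.setReg_hidden (r := 2 * d + 9) (h.reg m) (by omega) (by omega)
      (by omega)).setReg j 0
    obtain ⟨s', h1, h2, h3⟩ := loop (h.reg m) (h.setReg j 0) _ hs₁
      (by rw [hid]; simp [State.setReg])
    refine ⟨s', ?_, h2, ?_⟩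
    · have hm := Exec.move s (2 * d + 9) (2 * m)
      rw [hs.reg] at hm
      have := hm.seq ((Exec.const _ (2 * j) 0).seq h1)
      rw [show (Cmd.rep m j A).cost h = 1 + (1 + (1 + ∑ i ∈ Finset.range (h.reg m),
        (A.cost ((Cmd.iter j A)^[i] (h.setReg j 0)) + 3))) by simp only [Cmd.cost]; omega]
      exact this
    · intro q hq
      rw [h3 q hq, hid]
      simp only [State.setReg]
      rw [Function.update_of_ne (by omega)]

/-! ### Frames, loop invariants and syntactic cost bounds -/

namespace Cmd

/-- The registers that a command may change. -/
def regs : Cmd → List ℕ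
  | skip => []
  | const r _ | move r _ | add r _ _ | sub r _ _ | raw r _ | get r _ _ => [r]
  | put _ _ _ => []
  | seq A B | cond _ A B => A.regs ++ B.regs
  | rep _ j A => j :: A.regs

/-- The tables that a command may change. -/
def tabs : Cmd → List (Fin 16)
  | put t _ _ => [t]
  | seq A B | cond _ A B => A.tabs ++ B.tabs
  | rep _ _ A => A.tabs
  | _ => []

/-- `g` differs from `h` at most in what `c` may change. -/
structure Frame (c : Cmd) (h g : TState) : Prop where
  reg : ∀ r, r ∉ c.regs → g.reg r = h.reg r
  tab : ∀ t, t ∉ c.tabs → g.tab t = h.tab t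
  inp : g.inp = h.inp
  base : g.base = h.base

theorem frame_iterate {A : Cmd} (hA : ∀ h, Frame A h (A.run h)) (m j : ℕ) (h : TState) (k : ℕ) :
    Frame (rep m j A) h ((iter j A)^[k] (h.setReg j 0)) := by
  induction k with
  | zero =>
    refine ⟨fun r hr => ?_, fun _ _ => rfl, rfl, rfl⟩
    have : r ≠ j := fun h => hr (by simp [regs, h])
    simp [TState.setReg, this]
  | succ k ih =>
    rw [Function.iterate_succ_apply']
    have hf := hA ((iter j A)^[k] (h.setReg j 0))
    refine ⟨fun r hr => ?_, fun t ht => (hf.tab t ht).trans (ih.tab t ht), hf.inp.trans ih.inp,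
      hf.base.trans ih.base⟩
    rw [← ih.reg r hr]
    simp only [regs, List.mem_cons, not_or] at hr
    rw [← hf.reg r hr.2]
    simp [iter, TState.setReg, hr.1]

/-- For concrete commands, membership in `regs` and `tabs` is decidable, so that most preservation
facts below reduce to `decide`. -/
theorem frame_run (c : Cmd) : ∀ h, Frame c h (c.run h) := by
  have set : ∀ (c : Cmd) (h : TState) (r v : ℕ), c.regs = [r] → Frame c h (h.setReg r v) := by
    intro c h r v hc
    refine ⟨fun q hq => ?_, fun _ _ => rfl, rfl, rfl⟩
    rw [hc, List.mem_singleton] at hq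
    simp [TState.setReg, hq]
  induction c with
  | skip => exact fun h => ⟨fun _ _ => rfl, fun _ _ => rfl, rfl, rfl⟩
  | const | move | add | sub | raw | get => exact fun h => set _ h _ _ rfl
  | put t i r =>
    refine fun h => ⟨fun _ _ => rfl, fun u hu => ?_, rfl, rfl⟩
    have : u ≠ t := fun h => hu (by simp [tabs, h])
    simp [run, TState.setTab, this]
  | seq A B ihA ihB =>
    intro h
    have h1 := ihA h
    have h2 := ihB (A.run h)
    refine ⟨fun r hr => ?_, fun t ht => ?_, h2.inp.trans h1.inp, h2.base.trans h1.base⟩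
    · simp only [regs, List.mem_append, not_or] at hr
      exact (h2.reg r hr.2).trans (h1.reg r hr.1)
    · simp only [tabs, List.mem_append, not_or] at ht
      exact (h2.tab t ht.2).trans (h1.tab t ht.1)
  | cond r A B ihA ihB =>
    intro h
    have h1 := ihA h
    have h2 := ihB h
    simp only [run]
    split_ifs
    · exact ⟨fun r hr => h1.reg r fun h => hr (by simp [regs, h]),
        fun t ht => h1.tab t fun h => ht (by simp [tabs, h]), h1.inp, h1.base⟩
    · exact ⟨fun r hr => h2.reg r fun h => hr (by simp [regs, h]),
        fun t ht => h2.tab t fun h => ht (by simp [tabs, h]), h2.inp, h2.base⟩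
  | rep m j A ih => exact fun h => frame_iterate ih m j h _

theorem reg_run {c : Cmd} {r : ℕ} (hr : r ∉ c.regs) (h : TState) : (c.run h).reg r = h.reg r :=
  (c.frame_run h).reg r hr

theorem tab_run {c : Cmd} {t : Fin 16} (ht : t ∉ c.tabs) (h : TState) :
    (c.run h).tab t = h.tab t :=
  (c.frame_run h).tab t ht

/-- Loop invariants. -/
theorem rep_induction {m j : ℕ} {A : Cmd} {h : TState} (hj : j ∉ A.regs) (I : ℕ → TState → Prop)
    (zero : I 0 (h.setReg j 0))
    (step : ∀ i g, i < h.reg m → g.reg j = i → Frame (rep m j A) h g → I i g →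
      I (i + 1) ((A.run g).setReg j (i + 1))) :
    I (h.reg m) ((rep m j A).run h) := by
  rw [run_rep]
  suffices ∀ k, k ≤ h.reg m → I k ((iter j A)^[k] (h.setReg j 0)) ∧
      ((iter j A)^[k] (h.setReg j 0)).reg j = k from (this _ le_rfl).1
  intro k
  induction k with
  | zero => exact fun _ => ⟨zero, by simp [TState.setReg]⟩
  | succ k ih =>
    intro hk
    obtain ⟨h1, h2⟩ := ih (by omega)
    rw [Function.iterate_succ_apply']
    have hreg := reg_run hj ((iter j A)^[k] (h.setReg j 0))
    have := step k _ hk h2 (frame_iterate A.frame_run m j h k) h1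
    rw [show iter j A ((iter j A)^[k] (h.setReg j 0)) =
      (A.run ((iter j A)^[k] (h.setReg j 0))).setReg j (k + 1) by rw [iter, hreg, h2]]
    exact ⟨this, by simp [TState.setReg]⟩

/-- An upper bound on the cost, given the values of the registers that bound the loops. -/
def bound (v : ℕ → ℕ) : Cmd → ℕ
  | skip | const _ _ | move _ _ | add _ _ _ | sub _ _ _ | raw _ _ => 1
  | get _ _ _ | put _ _ _ => 8
  | seq A B => A.bound v + B.bound v
  | cond _ A B => A.bound v + B.bound v + 1
  | rep m _ A => 3 + v m * (A.bound v + 3)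

/-- The registers that bound loops. -/
def limits : Cmd → List ℕ
  | seq A B | cond _ A B => A.limits ++ B.limits
  | rep m _ A => m :: A.limits
  | _ => []

/-- No register of `S` is ever changed, so every loop limit has its initial value whenever the loop
is entered, however deep it is nested. -/
theorem cost_le_bound (c : Cmd) (v : ℕ → ℕ) (S : List ℕ) (hl : ∀ r ∈ c.limits, r ∈ S)
    (hd : ∀ r ∈ S, r ∉ c.regs) (h : TState) (hv : ∀ r ∈ S, h.reg r = v r) :
    c.cost h ≤ c.bound v := by
  induction c generalizing h with
  | seq A B ihA ihB =>
    simp only [limits, regs, List.mem_append, not_or] at hl hd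
    refine add_le_add (ihA (fun r hr => hl r (.inl hr)) (fun r hr => (hd r hr).1) h hv)
      (ihB (fun r hr => hl r (.inr hr)) (fun r hr => (hd r hr).2) _ fun r hr => ?_)
    rw [reg_run (hd r hr).1, hv r hr]
  | cond q A B ihA ihB =>
    simp only [limits, regs, List.mem_append, not_or] at hl hd
    have h1 := ihA (fun r hr => hl r (.inl hr)) (fun r hr => (hd r hr).1) h hv
    have h2 := ihB (fun r hr => hl r (.inr hr)) (fun r hr => (hd r hr).2) h hv
    simp only [cost, bound]
    split_ifs <;> omega
  | rep m j A ih =>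
    simp only [cost, bound, add_le_add_iff_left]
    have hm : h.reg m = v m := hv m (hl m (by simp [limits]))
    rw [hm]
    refine (Finset.sum_le_card_nsmul _ _ (A.bound v + 3) fun i _ => ?_).trans (by simp)
    refine Nat.add_le_add_right (ih (fun r hr => hl r (by simp [limits, hr]))
      (fun r hr h => hd r hr (by simp [regs, h])) _ fun r hr => ?_) 3
    rw [(frame_iterate A.frame_run m j h i).reg r (hd r hr), hv r hr]
  | _ => exact le_rfl

end Cmd

open Cmd

/-! ### The decision procedure

Registers: `0` answer, `1` number of events, `2` number of threads, `3` the constant one, `4` set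
when a read fails, `5` the last event of the block to be run, `6` the label of its thread, `7` set
when a runnable thread has been found, `8` and `9` loop counters, `10` to `19` scratch, `20` to `22`
used for parsing, from `30` on the guessed events.

Tables, by event: `0` label of the thread, `1` kind, `2` variable, `3` value plus one, `4` whether
done; by variable: `5` label of the writer, `6` final value plus one, `7` current value plus one;
by label: `8` zero if the thread is runnable. -/

/-- Set register `r` to a nonzero value iff registers `u` and `v` differ. -/
def neq (r u v : ℕ) : Cmd := .seq (.sub 19 v u) (.seq (.sub r u v) (.add r r 19))

def whenZero (r : ℕ) (A : Cmd) : Cmd := .cond r .skip A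

def whenNonzero (r : ℕ) (A : Cmd) : Cmd := .cond r A .skip

/-- At the end of a thread, go on to the next one. -/
def parseHead : Cmd := whenZero 21 (.seq (.add 22 22 3) (.seq (.raw 21 20) (.add 20 20 3)))

/-- Read one operation. -/
def parseTail : Cmd :=
  .seq (.seq (.raw 10 20) (.seq (.put 1 8 10) (.add 20 20 3)))
  (.seq (.seq (.raw 10 20) (.seq (.put 2 8 10) (.add 20 20 3)))
  (.seq (.seq (.raw 10 20) (.seq (.add 10 10 3) (.seq (.put 3 8 10) (.add 20 20 3))))
  (.seq (.put 0 8 22) (.sub 21 21 3))))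

def parseBody : Cmd := .seq parseHead parseTail

/-- The scan meets the writes to a variable in program order, so the value left behind is the final
one. -/
def ownerBody : Cmd :=
  .seq (.get 10 1 8) (whenNonzero 10 (.seq (.get 11 2 8) (.seq (.get 12 3 8) (.seq (.put 6 11 12)
    (.seq (.get 12 0 8) (.put 5 11 12))))))

/-- Fill the tables `0`, `1`, `2`, `3`, `5`, `6`. -/
def parse : Cmd :=
  .seq (.const 3 1) (.seq (.const 20 1) (.seq (.const 21 0) (.seq (.const 22 0)
    (.seq (.rep 1 8 parseBody) (.rep 1 8 ownerBody)))))

/-- Current values are cleared by visiting events, not variables: variable names are unbounded, but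
only those that occur in the program can have a value. -/
def resetBody : Cmd :=
  .seq (.const 10 0) (.seq (.put 4 8 10) (.seq (.get 11 2 8) (.put 7 11 10)))

/-- A failed read only raises the flag in register `4`. Execution goes on, so the tables describe
the set of executed events in every case. -/
def execEvent : Cmd :=
  .seq (.put 4 8 3) (.seq (.get 12 2 8) (.seq (.get 13 3 8) (.seq (.get 10 1 8)
    (.cond 10 (.put 7 12 13) (.seq (.get 14 7 12) (.seq (neq 11 14 13)
      (whenNonzero 11 (.const 4 1))))))))

def blockBody : Cmd :=
  .seq (.get 10 4 8) (whenZero 10 (.seq (.get 10 0 8) (.seq (neq 11 10 6)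
    (whenZero 11 (.seq (.sub 11 8 5) (whenZero 11 execEvent))))))

/-- Run the block that ends with the event in register `5`. -/
def runBlock : Cmd := .seq (.get 6 0 5) (.rep 1 8 blockBody)

def markAllBody : Cmd := .seq (.get 10 0 8) (.put 8 10 3)

def unmarkBody : Cmd :=
  .seq (.get 10 4 8) (whenZero 10 (.seq (.get 10 0 8) (.seq (.const 11 0) (.put 8 10 11))))

/-- An unfinished read of a foreign variable can exclude two threads: its own, if the current value
is wrong, and the writer, if the final value is wrong. If nobody writes the variable, the owner is
`0` and the second mark hits cell `0`, which is harmless as labels start with one. -/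
def markBody : Cmd :=
  .seq (.get 10 4 8) (whenZero 10 (.seq (.get 10 1 8) (whenZero 10 (.seq (.get 12 2 8)
    (.seq (.get 13 0 8) (.seq (.get 14 5 12) (.seq (neq 11 13 14) (whenNonzero 11
      (.seq (.get 15 3 8) (.seq (.get 16 7 12) (.seq (neq 11 16 15)
        (.seq (whenNonzero 11 (.put 8 13 3)) (.seq (.get 16 6 12) (.seq (neq 11 16 15)
          (whenNonzero 11 (.put 8 14 3))))))))))))))))

def pickBody : Cmd :=
  .seq (.get 10 0 8) (.seq (.get 10 8 10) (whenZero 10 (.seq (.const 7 1) (.move 5 8))))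

def roundCmd : Cmd :=
  .seq (.rep 1 8 markAllBody) (.seq (.rep 1 8 unmarkBody) (.seq (.rep 1 8 markBody)
    (.seq (.const 7 0) (.seq (.rep 1 8 pickBody) (whenNonzero 7 runBlock)))))

def saturate : Cmd := .rep 2 9 roundCmd

/-- The guess in register `30 + t` is used when `t + 1` charged blocks are left, which fits
induction on the budget of `Completable`. -/
def phases : ℕ → Cmd
  | 0 => saturate
  | t + 1 => .seq saturate (.seq (.move 5 (30 + t)) (.seq runBlock (phases t)))

def finalBody : Cmd := .seq (.get 10 4 8) (whenZero 10 (.const 4 1))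

/-- Test one guess of the `b` preempted events. -/
def check (b : ℕ) : Cmd :=
  .seq (.rep 1 8 resetBody) (.seq (.const 4 0) (.seq (phases b) (.seq (.rep 1 8 finalBody)
    (whenZero 4 (.const 0 1)))))

/-- Run `A` for all values of the guess registers. -/
def enumerate (A : Cmd) : ℕ → Cmd
  | 0 => A
  | t + 1 => .rep 1 (30 + t) (enumerate A t)

def decideVSC (b : ℕ) : Cmd := .seq parse (enumerate (check b) b)

/-- Zero iff `a = b`. -/
def differ (a b : ℕ) : ℕ := a - b + (b - a)

@[simp]
theorem differ_eq_zero {a b : ℕ} : differ a b = 0 ↔ a = b := by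
  unfold differ
  omega

@[simp]
theorem run_neq {r u v : ℕ} (hr : r ≠ 19) (hu : u ≠ 19) (hv : v ≠ 19) (h : TState) :
    (neq r u v).run h =
      (h.setReg 19 (h.reg v - h.reg u)).setReg r (differ (h.reg u) (h.reg v)) := by
  simp [neq, run, TState.setReg, differ, hu, hv, hr.symm]

/-! ### Effect of single loop bodies -/

theorem run_blockBody (g : TState) :
    ((blockBody.run g).tab 4 =
      if g.tab 4 (g.reg 8) = 0 ∧ g.tab 0 (g.reg 8) = g.reg 6 ∧ g.reg 8 ≤ g.reg 5 then
        Function.update (g.tab 4) (g.reg 8) (g.reg 3) else g.tab 4) ∧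
    ((blockBody.run g).tab 7 =
      if (g.tab 4 (g.reg 8) = 0 ∧ g.tab 0 (g.reg 8) = g.reg 6 ∧ g.reg 8 ≤ g.reg 5) ∧
          g.tab 1 (g.reg 8) ≠ 0 then
        Function.update (g.tab 7) (g.tab 2 (g.reg 8)) (g.tab 3 (g.reg 8)) else g.tab 7) ∧
    ((blockBody.run g).reg 4 =
      if (g.tab 4 (g.reg 8) = 0 ∧ g.tab 0 (g.reg 8) = g.reg 6 ∧ g.reg 8 ≤ g.reg 5) ∧
          g.tab 1 (g.reg 8) = 0 ∧ g.tab 7 (g.tab 2 (g.reg 8)) ≠ g.tab 3 (g.reg 8) then 1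
        else g.reg 4) := by
  by_cases h1 : g.tab 4 (g.reg 8) = 0 <;> by_cases h2 : g.tab 0 (g.reg 8) = g.reg 6 <;>
  by_cases h3 : g.reg 8 - g.reg 5 = 0 <;> by_cases h4 : g.tab 1 (g.reg 8) = 0 <;>
  by_cases h5 : g.tab 7 (g.tab 2 (g.reg 8)) = g.tab 3 (g.reg 8) <;>
  simp [blockBody, execEvent, whenZero, whenNonzero, run, TState.setReg, TState.setTab,
    ← Nat.sub_eq_zero_iff_le, h1, h2, h3, h4, h5]

theorem run_markBody (g : TState) :
    (markBody.run g).tab 8 =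
      if g.tab 4 (g.reg 8) = 0 ∧ g.tab 1 (g.reg 8) = 0 ∧
          g.tab 0 (g.reg 8) ≠ g.tab 5 (g.tab 2 (g.reg 8)) then
        (fun q => if (g.tab 7 (g.tab 2 (g.reg 8)) ≠ g.tab 3 (g.reg 8) ∧ q = g.tab 0 (g.reg 8)) ∨
            (g.tab 6 (g.tab 2 (g.reg 8)) ≠ g.tab 3 (g.reg 8) ∧ q = g.tab 5 (g.tab 2 (g.reg 8)))
          then g.reg 3 else g.tab 8 q) else g.tab 8 := by
  by_cases h1 : g.tab 4 (g.reg 8) = 0 <;> by_cases h2 : g.tab 1 (g.reg 8) = 0 <;>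
  by_cases h3 : g.tab 0 (g.reg 8) = g.tab 5 (g.tab 2 (g.reg 8)) <;>
  by_cases h4 : g.tab 7 (g.tab 2 (g.reg 8)) = g.tab 3 (g.reg 8) <;>
  by_cases h5 : g.tab 6 (g.tab 2 (g.reg 8)) = g.tab 3 (g.reg 8) <;>
  simp [markBody, whenZero, whenNonzero, run, TState.setReg, TState.setTab,
    h1, h2, h3, h4, h5, funext_iff, Function.update_apply]
  grind

/-! ### What registers and tables represent -/

open ConcProg

variable {P : ConcProg}

@[simp]
theorem TState.setReg_tab (h : TState) (r v : ℕ) : (h.setReg r v).tab = h.tab := rfl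

theorem TState.setReg_reg_of_ne (h : TState) {r q : ℕ} (v : ℕ) (hq : q ≠ r) :
    (h.setReg r v).reg q = h.reg q := by
  simp [TState.setReg, hq]

/-- The operations of `P` are in the tables. -/
structure Loaded (P : ConcProg) (h : TState) : Prop where
  events : h.reg 1 = P.numEvents
  threads : h.reg 2 = P.numThreads
  one : h.reg 3 = 1
  label : ∀ e : P.Event, h.tab 0 (index e) = e.1.val + 1
  read : ∀ (e : P.Event) x d, P.op e = .read x d →
    h.tab 1 (index e) = 0 ∧ h.tab 2 (index e) = x ∧ h.tab 3 (index e) = d + 1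
  write : ∀ (e : P.Event) x d, P.op e = .write x d →
    h.tab 1 (index e) = 1 ∧ h.tab 2 (index e) = x ∧ h.tab 3 (index e) = d + 1

/-- In addition, the tables of writers and of final values are filled. -/
structure Prepared (P : ConcProg) (h : TState) : Prop extends Loaded P h where
  owner : ∀ (e : P.Event) x d, P.op e = .write x d → h.tab 5 x = e.1.val + 1
  no_owner : ∀ x, (∀ (e : P.Event) d, P.op e ≠ .write x d) → h.tab 5 x = 0
  final : ∀ x d, h.tab 6 x = d + 1 ↔ Holds (Set.univ : Set P.Event) x d

/-- The tables of finished events and current values belong to the set `D`. -/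
structure Tracks (D : Set P.Event) (h : TState) : Prop where
  done : ∀ e, h.tab 4 (index e) ≠ 0 ↔ e ∈ D
  current : ∀ x d, h.tab 7 x = d + 1 ↔ Holds D x d

theorem Loaded.congr {h g : TState} (hh : Loaded P h) (hr : ∀ r ∈ [1, 2, 3], g.reg r = h.reg r)
    (ht : ∀ t ∈ ([0, 1, 2, 3] : List (Fin 16)), g.tab t = h.tab t) : Loaded P g := by
  simp only [List.mem_cons, List.not_mem_nil, or_false, forall_eq_or_imp, forall_eq] at hr ht
  obtain ⟨h1, h2, h3⟩ := hr
  obtain ⟨t0, t1, t2, t3⟩ := ht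
  exact ⟨h1.trans hh.events, h2.trans hh.threads, h3.trans hh.one, t0 ▸ hh.label,
    t1 ▸ t2 ▸ t3 ▸ hh.read, t1 ▸ t2 ▸ t3 ▸ hh.write⟩

theorem Prepared.congr {h g : TState} (hh : Prepared P h)
    (hr : ∀ r ∈ [1, 2, 3], g.reg r = h.reg r)
    (ht : ∀ t ∈ ([0, 1, 2, 3, 5, 6] : List (Fin 16)), g.tab t = h.tab t) : Prepared P g := by
  have hl := hh.toLoaded.congr hr (fun t h => ht t (by simp at h ⊢; tauto))
  have t5 := ht 5 (by simp)
  have t6 := ht 6 (by simp)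
  exact ⟨hl, t5 ▸ hh.owner, t5 ▸ hh.no_owner, t6 ▸ hh.final⟩

theorem Prepared.frame {c : Cmd} {h g : TState} (hh : Prepared P h) (hf : Frame c h g)
    (hr : ∀ r ∈ [1, 2, 3], r ∉ c.regs)
    (ht : ∀ t ∈ ([0, 1, 2, 3, 5, 6] : List (Fin 16)), t ∉ c.tabs) : Prepared P g :=
  hh.congr (fun r h => hf.reg r (hr r h)) fun t h => hf.tab t (ht t h)

theorem Tracks.congr {D : Set P.Event} {h g : TState} (hh : Tracks D h) (h4 : g.tab 4 = h.tab 4)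
    (h7 : g.tab 7 = h.tab 7) : Tracks D g :=
  ⟨h4 ▸ hh.done, h7 ▸ hh.current⟩

theorem Tracks.eq_zero_iff {D : Set P.Event} {h : TState} (hh : Tracks D h) (e : P.Event) :
    h.tab 4 (index e) = 0 ↔ e ∉ D := by
  rw [← hh.done, not_not]

/-- Invariants of loops over all events. -/
theorem rep_events {A : Cmd} {h : TState} (hn : h.reg 1 = P.numEvents) (hj : 8 ∉ A.regs)
    (I : ℕ → TState → Prop) (zero : I 0 (h.setReg 8 0))
    (step : ∀ (e : P.Event) g, g.reg 8 = index e → Frame (rep 1 8 A) h g → I (index e) g →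
      I (index e + 1) ((A.run g).setReg 8 (index e + 1))) :
    I P.numEvents ((rep 1 8 A).run h) := by
  rw [← hn]
  refine rep_induction hj I zero fun i g hi hg hf hI => ?_
  obtain ⟨e, rfl⟩ := exists_index_eq (hn ▸ hi)
  exact step e g hg hf hI

/-! ### Scanning the events of a block -/

theorem index_lt_succ_iff {e f : P.Event} : index f < index e + 1 ↔ f = e ∨ index f < index e := by
  rw [Nat.lt_succ_iff_lt_or_eq, or_comm]
  exact or_congr ⟨fun h => index_injective h, fun h => h ▸ rfl⟩ Iff.rfl

theorem programOrder_iff {e f : P.Event} (h : e.1 = f.1) :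
    P.ProgramOrder e f ↔ index e < index f := by
  refine ⟨index_lt_of_programOrder, fun hlt => ⟨h, ?_⟩⟩
  have h1 : e.1.val = f.1.val := congrArg Fin.val h
  unfold index at hlt
  rw [h1] at hlt
  omega

theorem mem_block_iff {D : Set P.Event} {a e : P.Event} :
    e ∈ block D a ↔ e ∉ D ∧ e.1 = a.1 ∧ index e ≤ index a := by
  refine and_congr_right fun _ => and_congr_right fun h => ?_
  have h1 : e.1.val = a.1.val := congrArg Fin.val h
  unfold index
  rw [h1]
  omega

/-- The events of the block of `a` with index below `i`, and those of `D`. -/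
def partialBlock (D : Set P.Event) (a : P.Event) (i : ℕ) : Set P.Event :=
  D ∪ {e | e ∈ block D a ∧ index e < i}

theorem partialBlock_zero (D : Set P.Event) (a : P.Event) : partialBlock D a 0 = D := by
  simp [partialBlock]

theorem partialBlock_numEvents (D : Set P.Event) (a : P.Event) :
    partialBlock D a P.numEvents = D ∪ block D a := by
  simp [partialBlock, index_lt]

theorem partialBlock_succ_of_mem {D : Set P.Event} {a e : P.Event} (he : e ∈ block D a) :
    partialBlock D a (index e + 1) = insert e (partialBlock D a (index e)) := by
  ext f
  simp only [partialBlock, Set.mem_union, Set.mem_ofPred_eq, index_lt_succ_iff, Set.mem_insert_iff]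
  constructor
  · tauto
  · rintro (rfl | h) <;> tauto

theorem partialBlock_succ_of_not_mem {D : Set P.Event} {a e : P.Event} (he : e ∉ block D a) :
    partialBlock D a (index e + 1) = partialBlock D a (index e) := by
  ext f
  simp only [partialBlock, Set.mem_union, Set.mem_ofPred_eq, index_lt_succ_iff]
  constructor
  · rintro (h | ⟨h, rfl | h'⟩) <;> tauto
  · tauto

theorem partialBlock_eq {D : Set P.Event} {a e : P.Event} (he : e ∈ block D a) :
    D ∪ {f | f ∈ block D a ∧ P.ProgramOrder f e} = partialBlock D a (index e) := by
  ext f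
  simp only [partialBlock, Set.mem_union, Set.mem_ofPred_eq]
  refine or_congr_right (and_congr_right fun hf => ?_)
  exact programOrder_iff (hf.2.1.trans he.2.1.symm)

/-- A scan by index meets the events of the block in program order, so before event `e` exactly
`partialBlock D a (index e)` has been executed. The tables are tracked whether or not reads fail;
the flag accumulates the failures. -/
theorem run_runBlock (hP : P.OneWriter) {D : Set P.Event} (hD : DownClosed D) {h : TState}
    (hh : Prepared P h) (ht : Tracks D h) {a : P.Event} (ha : h.reg 5 = index a) :
    Tracks (D ∪ block D a) (runBlock.run h) ∧
      ((runBlock.run h).reg 4 = 0 ↔ h.reg 4 = 0 ∧ BlockEnabled D a) := by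
  classical
  let h' := h.setReg 6 (a.1.val + 1)
  have hrun : runBlock.run h = (rep 1 8 blockBody).run h' := by
    simp only [runBlock, run, ha, hh.label]
    rfl
  have hh' : Prepared P h' := hh.congr (fun r hr => h.setReg_reg_of_ne _ (by
    simp at hr; omega)) fun _ _ => rfl
  have key := rep_events (A := blockBody) hh'.events (by decide)
    (fun i g => Tracks (partialBlock D a i) g ∧ (g.reg 4 = 0 ↔ h.reg 4 = 0 ∧
      ∀ e ∈ block D a, index e < i → Enabled (partialBlock D a (index e)) e))
    ⟨by rw [partialBlock_zero]; exact ht.congr rfl rfl, by simp [h', TState.setReg]⟩ ?_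
  · rw [hrun, partialBlock_numEvents] at *
    refine ⟨key.1, key.2.trans (and_congr_right fun _ => ?_)⟩
    refine forall₂_congr fun e he => ?_
    rw [partialBlock_eq he]
    simp [index_lt]
  · rintro e g hg hf ⟨ht, hfail⟩
    have hgP : Prepared P g := hh'.frame hf (by decide) (by decide)
    have h5 : g.reg 5 = index a := (hf.reg 5 (by decide)).trans ha
    have h6 : g.reg 6 = a.1.val + 1 := hf.reg 6 (by decide)
    obtain ⟨b4, b7, br⟩ := run_blockBody g
    have hmem : (g.tab 4 (g.reg 8) = 0 ∧ g.tab 0 (g.reg 8) = g.reg 6 ∧ g.reg 8 ≤ g.reg 5) ↔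
        e ∈ block D a := by
      rw [mem_block_iff, hg, h5, h6, hgP.label, ht.eq_zero_iff]
      have : e.1.val + 1 = a.1.val + 1 ↔ e.1 = a.1 := by rw [add_left_inj, Fin.ext_iff]
      rw [this]
      refine and_congr_left fun _ => not_congr ?_
      simp [partialBlock]
    simp only [hmem] at b4 b7 br
    rw [hg] at b4 b7 br
    by_cases he : e ∈ block D a
    -- No executed event follows `e` in its thread, so a write `e` really determines the current
    -- value.
    · have hpo : ∀ f ∈ partialBlock D a (index e), ¬ P.ProgramOrder e f := by
        rintro f (hf | hf) hpo
        · exact he.1 (hD e f hpo hf)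
        · have := index_lt_of_programOrder hpo
          have := hf.2
          omega
      have hdone : ∀ f : P.Event, (blockBody.run g).tab 4 (index f) ≠ 0 ↔
          f ∈ partialBlock D a (index e + 1) := by
        intro f
        rw [b4, if_pos he, hgP.one, partialBlock_succ_of_mem he, Set.mem_insert_iff, ← ht.done,
          Function.update_apply]
        by_cases hfe : f = e
        · simp [hfe]
        · simp [hfe, index_injective.ne hfe]
      have hall : (∀ f ∈ block D a, index f < index e + 1 → Enabled (partialBlock D a (index f)) f)
          ↔ (∀ f ∈ block D a, index f < index e → Enabled (partialBlock D a (index f)) f) ∧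
            Enabled (partialBlock D a (index e)) e := by
        simp only [index_lt_succ_iff]
        constructor
        · exact fun h => ⟨fun f hf hlt => h f hf (.inr hlt), h e he (.inl rfl)⟩
        · rintro ⟨h1, h2⟩ f hf (rfl | hlt)
          · exact h2
          · exact h1 f hf hlt
      rw [hall, ← and_assoc, ← hfail, TState.setReg_reg_of_ne _ _ (by decide), br]
      cases hop : P.op e with
      | read x d =>
        obtain ⟨k1, k2, k3⟩ := hgP.read e x d hop
        rw [k1, k2, k3]
        rw [k1] at b7
        refine ⟨⟨hdone, fun y d' => ?_⟩, ?_⟩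
        · rw [TState.setReg_tab, b7, if_neg (by simp), ht.current, partialBlock_succ_of_mem he]
          exact (holds_insert_of_ne (by simp [hop]) d').symm
        · have : Enabled (partialBlock D a (index e)) e ↔ g.tab 7 x = d + 1 := by
            rw [ht.current]
            constructor
            · exact fun h => h x d hop
            · intro h x' d' hop'
              rw [hop] at hop'
              cases hop'
              exact h
          rw [this]
          by_cases h7 : g.tab 7 x = d + 1 <;> simp [h7, he]
      | write x d =>
        obtain ⟨k1, k2, k3⟩ := hgP.write e x d hop
        rw [k1]
        rw [k1, k2, k3] at b7
        refine ⟨⟨hdone, fun y d' => ?_⟩, ?_⟩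
        · rw [TState.setReg_tab, b7, if_pos ⟨he, by simp⟩, partialBlock_succ_of_mem he]
          by_cases hy : y = x
          · subst hy
            rw [holds_insert_write hP hop hpo]
            simp [eq_comm]
          · rw [holds_insert_of_ne (by simp [hop]; intro h; exact (hy h.symm).elim), ← ht.current,
              Function.update_of_ne hy]
        · have : Enabled (partialBlock D a (index e)) e := by
            intro x' d' hop'
            rw [hop] at hop'
            cases hop'
          simp [this]
    · have hall : (∀ f ∈ block D a, index f < index e + 1 → Enabled (partialBlock D a (index f)) f)
          ↔ (∀ f ∈ block D a, index f < index e → Enabled (partialBlock D a (index f)) f) := by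
        simp only [index_lt_succ_iff]
        constructor
        · exact fun h f hf hlt => h f hf (.inr hlt)
        · rintro h1 f hf (rfl | hlt)
          · exact (he hf).elim
          · exact h1 f hf hlt
      rw [hall, ← hfail, partialBlock_succ_of_not_mem he, TState.setReg_reg_of_ne _ _ (by decide)]
      simp only [he, if_false, false_and] at b4 b7 br
      exact ⟨ht.congr b4 b7, by rw [br]⟩

/-! ### Rounds of saturation -/

theorem Prepared.run {h : TState} (hh : Prepared P h) {c : Cmd}
    (hr : ∀ r ∈ [1, 2, 3], r ∉ c.regs)
    (ht : ∀ t ∈ ([0, 1, 2, 3, 5, 6] : List (Fin 16)), t ∉ c.tabs) : Prepared P (c.run h) :=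
  hh.frame (c.frame_run h) hr ht

theorem Tracks.run {D : Set P.Event} {h : TState} (hh : Tracks D h) {c : Cmd} (h4 : 4 ∉ c.tabs)
    (h7 : 7 ∉ c.tabs) : Tracks D (c.run h) :=
  hh.congr (tab_run h4 h) (tab_run h7 h)

theorem Prepared.owner_eq_iff {h : TState} (hh : Prepared P h) (i : Fin P.threads.length) (x : ℕ) :
    h.tab 5 x = i.val + 1 ↔ Writes i x := by
  constructor
  · intro hx
    by_contra hw
    have : ∃ (e : P.Event) (d : ℕ), P.op e = .write x d := by
      by_contra hno
      push Not at hno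
      have := hh.no_owner x hno
      omega
    obtain ⟨e, d, he⟩ := this
    have h1 := hh.owner e x d he
    exact hw ⟨e, d, Fin.ext (by omega), he⟩
  · rintro ⟨e, d, rfl, he⟩
    exact hh.owner e x d he

/-- The read `e` shows that thread `i` is not runnable. -/
def Blocks (D : Set P.Event) (e : P.Event) (i : Fin P.threads.length) : Prop :=
  e ∉ D ∧ ∃ x d, P.op e = .read x d ∧ ¬ Writes e.1 x ∧
    ((¬ Holds D x d ∧ i = e.1) ∨ (¬ Holds (Set.univ : Set P.Event) x d ∧ Writes i x))

/-- Recasts runnability as a condition on each pending read, as tested by `markBody`. That a read in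
another thread of a variable of `i` is a foreign read is the 1-Writer condition. -/
theorem runnable_iff (hP : P.OneWriter) {D : Set P.Event} {i : Fin P.threads.length} :
    Runnable D i ↔ (∃ e, e ∉ D ∧ e.1 = i) ∧ ∀ e, ¬ Blocks D e i := by
  refine and_congr_right fun _ => ?_
  constructor
  · rintro ⟨h1, h2⟩ e ⟨he, x, d, hop, hw, ⟨hh, rfl⟩ | ⟨hh, hwi⟩⟩
    · exact hh (h1 e he rfl x d hop hw)
    · exact hh (h2 e he (fun h => hw (h ▸ hwi)) x d hop hwi)
  · intro h
    constructor
    · rintro e he rfl x d hop hw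
      by_contra hh
      exact h e ⟨he, x, d, hop, hw, .inl ⟨hh, rfl⟩⟩
    · intro e he hei x d hop hw
      by_contra hh
      refine h e ⟨he, x, d, hop, ?_, .inr ⟨hh, hw⟩⟩
      rintro ⟨f, d₁, hf, hfw⟩
      obtain ⟨g, d₂, hg, hgw⟩ := hw
      exact hei (hf.symm.trans ((hP f g x d₁ d₂ hfw hgw).trans hg))

theorem run_markAll {h : TState} (hh : Prepared P h) (i : Fin P.threads.length) :
    ((rep 1 8 markAllBody).run h).tab 8 (i.val + 1) ≠ 0 := by
  have key := rep_events (A := markAllBody) hh.events (by decide)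
    (fun i g => ∀ e : P.Event, index e < i → g.tab 8 (e.1.val + 1) = 1) (by simp) ?_
  · obtain ⟨e, rfl⟩ := exists_event i
    rw [key e (index_lt e)]
    decide
  · intro e g hg hf hI f hfe
    have hgP : Prepared P g := hh.frame hf (by decide) (by decide)
    have : (markAllBody.run g).tab 8 = Function.update (g.tab 8) (e.1.val + 1) 1 := by
      simp [markAllBody, run, TState.setReg, TState.setTab, hg, hgP.label, hgP.one]
    rw [TState.setReg_tab, this, Function.update_apply]
    rcases index_lt_succ_iff.1 hfe with rfl | hlt
    · simp
    · rw [hI f hlt]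
      simp

theorem run_unmark {D : Set P.Event} {h : TState} (hh : Prepared P h) (ht : Tracks D h)
    (h8 : ∀ i : Fin P.threads.length, h.tab 8 (i.val + 1) ≠ 0) (i : Fin P.threads.length) :
    ((rep 1 8 unmarkBody).run h).tab 8 (i.val + 1) = 0 ↔ ∃ e, e ∉ D ∧ e.1 = i := by
  have key := rep_events (A := unmarkBody) hh.events (by decide)
    (fun q g => g.tab 8 (i.val + 1) = 0 ↔ ∃ e, index e < q ∧ e ∉ D ∧ e.1 = i) (by simp [h8]) ?_
  · simpa [index_lt] using key
  · intro e g hg hf hI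
    have hgP : Prepared P g := hh.frame hf (by decide) (by decide)
    have hgT : Tracks D g := ht.congr (hf.tab 4 (by decide)) (hf.tab 7 (by decide))
    have hz := hgT.eq_zero_iff e
    simp only [index_lt_succ_iff, or_and_right, exists_or, exists_eq_left, ← hI,
      TState.setReg_tab]
    by_cases he : e ∈ D
    · have : (unmarkBody.run g).tab 8 = g.tab 8 := by
        have h0 : g.tab 4 (index e) ≠ 0 := (hgT.done e).2 he
        simp [unmarkBody, whenZero, run, TState.setReg, hg, h0]
      simp [this, he]
    · have : (unmarkBody.run g).tab 8 = Function.update (g.tab 8) (e.1.val + 1) 0 := by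
        simp [unmarkBody, whenZero, run, TState.setReg, TState.setTab, hg, hgP.label, hz.2 he]
      rw [this, Function.update_apply]
      by_cases hi : e.1 = i
      · simp [hi, he]
      · have : ¬ i.val = e.1.val := fun h => hi (Fin.ext h.symm)
        simp [hi, this]

theorem run_mark (hP : P.OneWriter) {D : Set P.Event} {h : TState} (hh : Prepared P h)
    (ht : Tracks D h) (i : Fin P.threads.length)
    (h8 : h.tab 8 (i.val + 1) = 0 ↔ ∃ e, e ∉ D ∧ e.1 = i) :
    ((rep 1 8 markBody).run h).tab 8 (i.val + 1) = 0 ↔ Runnable D i := by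
  classical
  have key := rep_events (A := markBody) hh.events (by decide)
    (fun q g => g.tab 8 (i.val + 1) = 0 ↔ (∃ e, e ∉ D ∧ e.1 = i) ∧
      ∀ e, index e < q → ¬ Blocks D e i) (by simpa using h8) ?_
  · rw [key, runnable_iff hP]
    simp [index_lt]
  · intro e g hg hf hI
    have hgP : Prepared P g := hh.frame hf (by decide) (by decide)
    have hgT : Tracks D g := ht.congr (hf.tab 4 (by decide)) (hf.tab 7 (by decide))
    have hall : (∀ f, index f < index e + 1 → ¬ Blocks D f i) ↔
        (∀ f, index f < index e → ¬ Blocks D f i) ∧ ¬ Blocks D e i := by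
      simp only [index_lt_succ_iff]
      constructor
      · exact fun h => ⟨fun f hf => h f (.inr hf), h e (.inl rfl)⟩
      · rintro ⟨h1, h2⟩ f (rfl | hf)
        · exact h2
        · exact h1 f hf
    rw [hall, ← and_assoc, ← hI, TState.setReg_tab, run_markBody, hg, hgP.one]
    cases hop : P.op e with
    | write x d =>
      have : ¬ Blocks D e i := by
        rintro ⟨-, x', d', hop', -⟩
        rw [hop] at hop'
        cases hop'
      simp [(hgP.write e x d hop).1, this]
    | read x d =>
      obtain ⟨k1, k2, k3⟩ := hgP.read e x d hop
      have hB : Blocks D e i ↔ e ∉ D ∧ ¬ Writes e.1 x ∧ ((¬ Holds D x d ∧ i = e.1) ∨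
          (¬ Holds (Set.univ : Set P.Event) x d ∧ Writes i x)) := by
        refine and_congr_right fun _ => ⟨?_, fun h => ⟨x, d, hop, h⟩⟩
        rintro ⟨x', d', hop', h⟩
        rw [hop] at hop'
        cases hop'
        exact h
      rw [k1, k2, k3, hB]
      simp only [hgP.label, ne_eq, hgT.current, hgP.final, hgT.eq_zero_iff]
      have hw : ¬ (e.1.val + 1 = g.tab 5 x) ↔ ¬ Writes e.1 x := by
        rw [eq_comm, hgP.owner_eq_iff]
      have hi : i.val + 1 = e.1.val + 1 ↔ i = e.1 := by rw [add_left_inj, Fin.ext_iff]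
      have hwi : i.val + 1 = g.tab 5 x ↔ Writes i x := by rw [eq_comm, hgP.owner_eq_iff]
      split_ifs with c1
      · rw [hw] at c1
        simp only [hi, hwi]
        split_ifs with c2
        · exact iff_of_false not_false fun h => h.2 ⟨c1.1, c1.2.2, c2⟩
        · exact ⟨fun h => ⟨h, fun h' => c2 h'.2.2⟩, fun h => h.1⟩
      · rw [hw] at c1
        exact ⟨fun h => ⟨h, fun h' => c1 ⟨h'.1, trivial, h'.2.1⟩⟩, fun h => h.1⟩

theorem run_pick {D : Set P.Event} {h : TState} (hh : Prepared P h)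
    (h8 : ∀ i : Fin P.threads.length, h.tab 8 (i.val + 1) = 0 ↔ Runnable D i) (h7 : h.reg 7 = 0) :
    (((rep 1 8 pickBody).run h).reg 7 = 0 ∧ ∀ i, ¬ Runnable D i) ∨
    (((rep 1 8 pickBody).run h).reg 7 ≠ 0 ∧
      ∃ a, ((rep 1 8 pickBody).run h).reg 5 = index a ∧ IsPick D a) := by
  have key := rep_events (A := pickBody) hh.events (by decide)
    (fun q g => (g.reg 7 = 0 ∧ ∀ e : P.Event, index e < q → ¬ Runnable D e.1) ∨
      (g.reg 7 ≠ 0 ∧ ∃ a, g.reg 5 = index a ∧ Runnable D a.1 ∧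
        ∀ e : P.Event, index e < q → Runnable D e.1 → index e ≤ index a))
    (.inl ⟨by simp [TState.setReg, h7], by simp⟩) ?_
  · refine key.imp (And.imp_right fun hk i => ?_) (And.imp_right ?_)
    · obtain ⟨e, rfl⟩ := exists_event i
      exact hk e (index_lt e)
    · rintro ⟨a, h1, h2, h3⟩
      exact ⟨a, h1, h2, fun e => h3 e (index_lt e)⟩
  · intro e g hg hf hI
    have hgP : Prepared P g := hh.frame hf (by decide) (by decide)
    have h8 : g.tab 8 (e.1.val + 1) = 0 ↔ Runnable D e.1 := by rw [hf.tab 8 (by decide), h8]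
    rw [TState.setReg_reg_of_ne _ _ (by decide), TState.setReg_reg_of_ne _ _ (by decide)]
    by_cases hr : Runnable D e.1
    · right
      have r7 : (pickBody.run g).reg 7 = 1 := by
        simp [pickBody, whenZero, run, TState.setReg, hg, hgP.label, h8.2 hr]
      have r5 : (pickBody.run g).reg 5 = index e := by
        simp [pickBody, whenZero, run, TState.setReg, hg, hgP.label, h8.2 hr]
      exact ⟨by simp [r7], e, r5, hr, fun f hf _ => by omega⟩
    · have h0 : g.tab 8 (e.1.val + 1) ≠ 0 := fun h => hr (h8.1 h)
      have r7 : (pickBody.run g).reg 7 = g.reg 7 := by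
        simp [pickBody, whenZero, run, TState.setReg, hg, hgP.label, h0]
      have r5 : (pickBody.run g).reg 5 = g.reg 5 := by
        simp [pickBody, whenZero, run, TState.setReg, hg, hgP.label, h0]
      rw [r7, r5]
      simp only [index_lt_succ_iff]
      refine hI.imp (And.imp_right fun hk f hf => ?_) (And.imp_right ?_)
      · rcases hf with rfl | hf
        · exact hr
        · exact hk f hf
      · rintro ⟨a, h1, h2, h3⟩
        refine ⟨a, h1, h2, fun f hf hfr => ?_⟩
        rcases hf with rfl | hf
        · exact (hr hfr).elim
        · exact h3 f hf hfr

/-- The conjunction of a clear flag and completability is what a round preserves: a read failing in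
a picked thread raises the flag, but then there was no completion in the first place. -/
theorem run_roundCmd (hP : P.OneWriter) {D : Set P.Event} (hD : DownClosed D) {h : TState}
    (hh : Prepared P h) (ht : Tracks D h) :
    Tracks (runPicked D) (roundCmd.run h) ∧ ∀ m,
      ((roundCmd.run h).reg 4 = 0 ∧ Completable (runPicked D) m ↔
        h.reg 4 = 0 ∧ Completable D m) := by
  let g₁ := (rep 1 8 markAllBody).run h
  let g₂ := (rep 1 8 unmarkBody).run g₁
  let g₃ := (rep 1 8 markBody).run g₂
  let g₄ := g₃.setReg 7 0
  let g₅ := (rep 1 8 pickBody).run g₄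
  have p₁ : Prepared P g₁ := hh.run (by decide) (by decide)
  have p₂ : Prepared P g₂ := p₁.run (by decide) (by decide)
  have p₄ : Prepared P g₄ :=
    (p₂.run (c := rep 1 8 markBody) (by decide) (by decide)).run (c := .const 7 0)
      (by decide) (by decide)
  have p₅ : Prepared P g₅ := p₄.run (by decide) (by decide)
  have t₁ : Tracks D g₁ := ht.run (by decide) (by decide)
  have t₂ : Tracks D g₂ := t₁.run (by decide) (by decide)
  have t₃ : Tracks D g₃ := t₂.run (by decide) (by decide)
  have t₅ : Tracks D g₅ := (t₃.congr (g := g₄) rfl rfl).run (by decide) (by decide)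
  have h8 : ∀ i : Fin P.threads.length, g₄.tab 8 (i.val + 1) = 0 ↔ Runnable D i := fun i =>
    run_mark hP p₂ t₂ i (run_unmark p₁ t₁ (run_markAll hh) i)
  have r4 : g₅.reg 4 = h.reg 4 := by
    rw [reg_run (by decide), TState.setReg_reg_of_ne _ _ (by decide), reg_run (by decide),
      reg_run (by decide), reg_run (by decide)]
  have hrun : roundCmd.run h = (whenNonzero 7 runBlock).run g₅ := rfl
  rw [hrun]
  rcases run_pick p₄ h8 (by simp [g₄, TState.setReg]) with ⟨h7, hs⟩ | ⟨h7, a, h5, ha⟩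
  · have h7 : g₅.reg 7 = 0 := h7
    have : (whenNonzero 7 runBlock).run g₅ = g₅ := by simp [whenNonzero, run, h7]
    rw [this, runPicked_of_stuck hs, r4]
    exact ⟨t₅, fun _ => Iff.rfl⟩
  · have h7 : g₅.reg 7 ≠ 0 := h7
    have : (whenNonzero 7 runBlock).run g₅ = runBlock.run g₅ := by simp [whenNonzero, run, h7]
    obtain ⟨k1, k2⟩ := run_runBlock hP hD p₅ t₅ h5
    rw [this, ha.runPicked_eq]
    refine ⟨k1, fun m => ?_⟩
    rw [k2, r4, completable_iff_of_runnable hP hD ha.1 ha.isLast, and_assoc]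

theorem run_saturate (hP : P.OneWriter) {D : Set P.Event} (hD : DownClosed D) {h : TState}
    (hh : Prepared P h) (ht : Tracks D h) :
    Tracks (runPicked^[P.numThreads] D) (saturate.run h) ∧ ∀ m,
      ((saturate.run h).reg 4 = 0 ∧ Completable (runPicked^[P.numThreads] D) m ↔
        h.reg 4 = 0 ∧ Completable D m) := by
  have key := rep_induction (m := 2) (j := 9) (A := roundCmd) (h := h) (by decide)
    (fun q g => Tracks (runPicked^[q] D) g ∧ ∀ m,
      (g.reg 4 = 0 ∧ Completable (runPicked^[q] D) m ↔ h.reg 4 = 0 ∧ Completable D m))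
    ⟨ht.congr rfl rfl, fun _ => Iff.rfl⟩ ?_
  · rwa [hh.threads] at key
  · rintro q g - - hf ⟨h1, h2⟩
    have hgP : Prepared P g := hh.frame hf (by decide) (by decide)
    obtain ⟨k1, k2⟩ := run_roundCmd hP (downClosed_iterate_runPicked hD q) hgP h1
    rw [Function.iterate_succ_apply']
    refine ⟨k1.congr rfl rfl, fun m => ?_⟩
    rw [TState.setReg_reg_of_ne _ _ (by decide), k2, h2]

/-! ### Phases and guesses -/

theorem mem_regs_seq {A B : Cmd} {r : ℕ} :
    r ∈ (Cmd.seq A B).regs ↔ r ∈ A.regs ∨ r ∈ B.regs :=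
  List.mem_append

theorem mem_regs_phases {t r : ℕ} (h : r ∈ (phases t).regs) : 4 ≤ r ∧ r < 20 := by
  have hs : ∀ r ∈ saturate.regs, 4 ≤ r ∧ r < 20 := by decide
  have hb : ∀ r ∈ runBlock.regs, 4 ≤ r ∧ r < 20 := by decide
  induction t with
  | zero => exact hs r h
  | succ t ih =>
    simp only [phases, regs, List.mem_append, List.mem_singleton] at h
    rcases h with h | rfl | h | h
    · exact hs r h
    · decide
    · exact hb r h
    · exact ih h

theorem mem_tabs_phases {t : ℕ} {u : Fin 16} (h : u ∈ (phases t).tabs) : u = 4 ∨ u = 7 ∨ u = 8 := by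
  have hs : ∀ r ∈ saturate.tabs, r = 4 ∨ r = 7 ∨ r = 8 := by decide
  have hb : ∀ r ∈ runBlock.tabs, r = 4 ∨ r = 7 ∨ r = 8 := by decide
  induction t with
  | zero => exact hs u h
  | succ t ih =>
    simp only [phases, tabs, List.mem_append, List.not_mem_nil, false_or] at h
    rcases h with h | h | h
    · exact hs u h
    · exact hb u h
    · exact ih h

/-- The effect of one phase: saturate, then run the block of a guessed event. -/
theorem run_phase (hP : P.OneWriter) {D : Set P.Event} (hD : DownClosed D) {h : TState}
    (hh : Prepared P h) (ht : Tracks D h) {t : ℕ} {a : P.Event} (ha : h.reg (30 + t) = index a) :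
    let D₁ := runPicked^[P.numThreads] D
    let g := runBlock.run ((Cmd.move 5 (30 + t)).run (saturate.run h))
    Prepared P g ∧ Tracks (D₁ ∪ block D₁ a) g ∧ (∀ i, g.reg (30 + i) = h.reg (30 + i)) ∧
      (g.reg 4 = 0 ↔ (saturate.run h).reg 4 = 0 ∧ BlockEnabled D₁ a) := by
  intro D₁ g
  have h1 := run_saturate hP hD hh ht
  have hreg : ∀ {c : Cmd}, (∀ r ∈ c.regs, r < 20) → ∀ (h : TState) (i : ℕ),
      (c.run h).reg (30 + i) = h.reg (30 + i) :=
    fun hc h i => reg_run (fun hm => by have := hc _ hm; omega) h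
  have p1 : Prepared P (saturate.run h) := hh.run (by decide) (by decide)
  have p2 : Prepared P ((Cmd.move 5 (30 + t)).run (saturate.run h)) :=
    p1.run (by simp [regs]) (by simp [tabs])
  obtain ⟨k1, k2⟩ := run_runBlock (a := a) hP (downClosed_iterate_runPicked hD P.numThreads) p2
    (h1.1.run (by simp [tabs]) (by simp [tabs])) (by
      simp only [run, TState.setReg, Function.update_self]
      rw [hreg (by decide), ha])
  refine ⟨p2.run (by decide) (by decide), k1, fun i => ?_, ?_⟩
  · rw [hreg (by decide), hreg (by simp [regs]), hreg (by decide)]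
  · rw [k2, reg_run (by simp [regs])]

/-- Soundness for arbitrary guesses: if everything ends up executed with a clear flag, the phases
traced out a completion with at most `t` charged blocks. -/
theorem run_phases_sound (hP : P.OneWriter) (t : ℕ) {D : Set P.Event} (hD : DownClosed D)
    {h : TState} (hh : Prepared P h) (ht : Tracks D h)
    (hg : ∀ i, i < t → ∃ a : P.Event, h.reg (30 + i) = index a) :
    ∃ D' : Set P.Event, Tracks D' ((phases t).run h) ∧
      (((phases t).run h).reg 4 = 0 → D' = Set.univ → h.reg 4 = 0 ∧ Completable D t) := by
  induction t generalizing D h with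
  | zero =>
    obtain ⟨k1, k2⟩ := run_saturate hP hD hh ht
    exact ⟨_, k1, fun h4 hu => (k2 0).1 ⟨h4, hu ▸ .done 0⟩⟩
  | succ t ih =>
    obtain ⟨a, ha⟩ := hg t (by omega)
    obtain ⟨p, k1, k2, k3⟩ := run_phase hP hD hh ht ha
    have hD₁ := downClosed_iterate_runPicked hD P.numThreads
    obtain ⟨D', i1, i2⟩ := ih (downClosed_union_block hD₁ a) p k1
      fun i hi => (hg i (by omega)).imp fun a ha => (k2 i).trans ha
    refine ⟨D', i1, fun h4 hu => ?_⟩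
    obtain ⟨j1, j2⟩ := i2 h4 hu
    obtain ⟨j3, j4⟩ := k3.1 j1
    refine ((run_saturate hP hD hh ht).2 (t + 1)).1 ⟨j3, ?_⟩
    -- A guess that is already executed has an empty block; it merely wastes one unit of the budget.
    by_cases haD : a ∈ runPicked^[P.numThreads] D
    · rw [block_eq_empty hD₁ haD, Set.union_empty] at j2
      exact j2.mono (Nat.le_succ t)
    · exact .preempt a haD j4 j2

/-- Completeness: the guesses are read off a completion. They are chosen before the state `h`, since
the enumeration must meet this one tuple from whatever state earlier tests have left. -/
theorem exists_guess (hP : P.OneWriter) (t : ℕ) {D : Set P.Event} (hD : DownClosed D)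
    (hc : Completable D t) :
    ∃ a : ℕ → P.Event, ∀ h, Prepared P h → Tracks D h → h.reg 4 = 0 →
      (∀ i, i < t → h.reg (30 + i) = index (a i)) →
      ((phases t).run h).reg 4 = 0 ∧ Tracks (Set.univ : Set P.Event) ((phases t).run h) := by
  have e₀ : P.Event := ⟨⟨0, List.length_pos_of_ne_nil P.threads_ne⟩, ⟨0, List.length_pos_of_ne_nil
    (P.thread_ne _ (List.get_mem _ _))⟩⟩
  induction t generalizing D with
  | zero =>
    refine ⟨fun _ => e₀, fun h hh ht h4 _ => ?_⟩
    obtain ⟨k1, k2⟩ := run_saturate hP hD hh ht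
    obtain ⟨j1, j2⟩ := (k2 0).2 ⟨h4, hc⟩
    rcases j2.of_stuck hP (downClosed_iterate_runPicked hD _) (stuck_iterate_runPicked D) with
      hu | ⟨q, a, hq, -⟩
    · exact ⟨j1, hu ▸ k1⟩
    · omega
  | succ t ih =>
    have hD₁ := downClosed_iterate_runPicked hD P.numThreads
    have hsat : Completable (runPicked^[P.numThreads] D) (t + 1) := by
      have : ∀ q, Completable (runPicked^[q] D) (t + 1) := by
        intro q
        induction q with
        | zero => exact hc
        | succ q ihq =>
          rw [Function.iterate_succ_apply']
          by_cases hr : ∃ i, Runnable (runPicked^[q] D) i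
          · obtain ⟨i, hi⟩ := hr
            obtain ⟨a, ha⟩ := exists_isPick hi
            rw [ha.runPicked_eq]
            exact ((completable_iff_of_runnable hP (downClosed_iterate_runPicked hD q) ha.1
              ha.isLast).1 ihq).2
          · rw [runPicked_of_stuck (not_exists.1 hr)]
            exact ihq
      exact this _
    have next : ∃ a₀ : P.Event, BlockEnabled (runPicked^[P.numThreads] D) a₀ ∧
        Completable (runPicked^[P.numThreads] D ∪ block (runPicked^[P.numThreads] D) a₀) t := by
      rcases hsat.of_stuck hP hD₁ (stuck_iterate_runPicked D) with hu | ⟨q, a, hq, hb, hq'⟩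
      -- If saturation has executed everything, any event will do as a guess, its block being empty.
      · refine ⟨e₀, fun e he => ?_, ?_⟩
        · rw [hu] at he
          exact (he.1 trivial).elim
        · rw [hu, Set.univ_union]
          exact .done t
      · obtain rfl : t = q := by omega
        exact ⟨a, hb, hq'⟩
    obtain ⟨a₀, hb, hc'⟩ := next
    obtain ⟨a, ha⟩ := ih (downClosed_union_block hD₁ a₀) hc'
    refine ⟨Function.update a t a₀, fun h hh ht h4 hg => ?_⟩
    have hgt := hg t (by omega)
    rw [Function.update_self] at hgt
    obtain ⟨p, k1, k2, k3⟩ := run_phase hP hD hh ht hgt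
    have hs := ((run_saturate hP hD hh ht).2 (t + 1)).2 ⟨h4, hc⟩
    refine ha _ p k1 (k3.2 ⟨hs.1, hb⟩) fun i hi => ?_
    rw [k2, hg i (by omega), Function.update_of_ne (by omega)]

/-- By `Tracks`, a nonzero current value belongs to a variable written by some event. The invariant
says that such a variable still occurs in an event to be visited; at the end there are none. -/
theorem run_reset {D : Set P.Event} {h : TState} (hh : Prepared P h) (ht : Tracks D h) :
    Tracks (∅ : Set P.Event) ((rep 1 8 resetBody).run h) := by
  have key := rep_events (A := resetBody) hh.events (by decide)
    (fun q g => (∀ e : P.Event, index e < q → g.tab 4 (index e) = 0) ∧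
      ∀ x, g.tab 7 x ≠ 0 → ∃ e : P.Event, q ≤ index e ∧ g.tab 2 (index e) = x) ?_ ?_
  · refine ⟨fun e => ?_, fun x d => ?_⟩
    · simp [key.1 e (index_lt e)]
    · have : ((rep 1 8 resetBody).run h).tab 7 x = 0 := by
        by_contra h0
        obtain ⟨e, he, -⟩ := key.2 x h0
        have := index_lt e
        omega
      simp [this, Holds]
  · refine ⟨by simp, fun x hx => ?_⟩
    obtain ⟨d, hd⟩ := Nat.exists_eq_succ_of_ne_zero hx
    obtain ⟨f, -, hf, -⟩ := (ht.current x d).1 hd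
    exact ⟨f, Nat.zero_le _, (hh.write f x d hf).2.1⟩
  · rintro e g hg hf ⟨h1, h2⟩
    have t4 : (resetBody.run g).tab 4 = Function.update (g.tab 4) (index e) 0 := by
      simp [resetBody, run, TState.setReg, TState.setTab, hg]
    have t7 : (resetBody.run g).tab 7 = Function.update (g.tab 7) (g.tab 2 (index e)) 0 := by
      simp [resetBody, run, TState.setReg, TState.setTab, hg]
    simp only [TState.setReg_tab, t4, t7, tab_run (c := resetBody) (t := 2) (by decide)]
    refine ⟨fun f hf => ?_, fun x hx => ?_⟩
    · rw [Function.update_apply]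
      split_ifs with hfe
      · rfl
      · exact h1 f (by omega)
    · rw [Function.update_apply] at hx
      split_ifs at hx with hxe
      · exact (hx rfl).elim
      · obtain ⟨f, hf1, hf2⟩ := h2 x hx
        refine ⟨f, ?_, hf2⟩
        rcases hf1.lt_or_eq with hlt | heq
        · exact hlt
        · exact (hxe (by rw [heq, hf2])).elim

theorem run_final {D : Set P.Event} {h : TState} (hh : Prepared P h) (ht : Tracks D h) :
    ((rep 1 8 finalBody).run h).reg 4 = 0 ↔ h.reg 4 = 0 ∧ D = Set.univ := by
  have key := rep_events (A := finalBody) hh.events (by decide)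
    (fun q g => g.reg 4 = 0 ↔ h.reg 4 = 0 ∧ ∀ e, index e < q → e ∈ D)
    (by simp [TState.setReg]) ?_
  · rw [key, Set.eq_univ_iff_forall]
    simp [index_lt]
  · intro e g hg hf hI
    have hgT : Tracks D g := ht.congr (hf.tab 4 (by decide)) (hf.tab 7 (by decide))
    rw [TState.setReg_reg_of_ne _ _ (by decide)]
    simp only [index_lt_succ_iff]
    by_cases he : e ∈ D
    · have h0 : g.tab 4 (index e) ≠ 0 := (hgT.done e).2 he
      have : (finalBody.run g).reg 4 = g.reg 4 := by
        simp [finalBody, whenZero, run, TState.setReg, hg, h0]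
      rw [this, hI]
      refine and_congr_right fun _ => ⟨?_, fun h f hf => h f (.inr hf)⟩
      rintro h f (rfl | hf)
      · exact he
      · exact h f hf
    · have h0 := (hgT.eq_zero_iff e).2 he
      have : (finalBody.run g).reg 4 = 1 := by
        simp [finalBody, whenZero, run, TState.setReg, hg, h0]
      rw [this]
      exact iff_of_false (by simp) fun h => he (h.2 e (.inl rfl))

/-- A state between two tests. -/
def Ready (P : ConcProg) (h : TState) : Prop := Prepared P h ∧ ∃ D : Set P.Event, Tracks D h

/-! ### Testing one guess and enumerating all guesses -/

theorem mem_regs_check {b r : ℕ} (h : r ∈ (check b).regs) : (r = 0 ∨ 4 ≤ r) ∧ r < 20 := by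
  have h1 : ∀ r ∈ (rep 1 8 resetBody).regs, (r = 0 ∨ 4 ≤ r) ∧ r < 20 := by decide
  have h2 : ∀ r ∈ (rep 1 8 finalBody).regs, (r = 0 ∨ 4 ≤ r) ∧ r < 20 := by decide
  have h3 : ∀ r ∈ (whenZero 4 (.const 0 1)).regs, (r = 0 ∨ 4 ≤ r) ∧ r < 20 := by decide
  have h4 : ∀ r ∈ (Cmd.const 4 0).regs, (r = 0 ∨ 4 ≤ r) ∧ r < 20 := by decide
  simp only [check, mem_regs_seq] at h
  rcases h with h | h | h | h | h
  · exact h1 r h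
  · exact h4 r h
  · have := mem_regs_phases h
    omega
  · exact h2 r h
  · exact h3 r h

theorem mem_tabs_check {b : ℕ} {u : Fin 16} (h : u ∈ (check b).tabs) : u = 4 ∨ u = 7 ∨ u = 8 := by
  have h1 : ∀ r ∈ (rep 1 8 resetBody).tabs, r = 4 ∨ r = 7 ∨ r = 8 := by decide
  have h2 : (Cmd.const 4 0).tabs = [] := rfl
  have h3 : (rep 1 8 finalBody).tabs = [] := rfl
  have h4 : (whenZero 4 (.const 0 1)).tabs = [] := rfl
  rw [check, tabs, tabs, tabs, tabs, h2, h3, h4] at h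
  simp only [List.mem_append, List.not_mem_nil, false_or, or_false] at h
  exact h.elim (h1 u) mem_tabs_phases

/-- The first half is soundness and the restoration of `Ready`, for every tuple of guesses; the
second provides one tuple that succeeds from every ready state. -/
theorem run_check (hP : P.OneWriter) (b : ℕ) :
    (∀ h, Ready P h → (∀ i, i < b → ∃ a : P.Event, h.reg (30 + i) = index a) →
      Ready P ((check b).run h) ∧
        (((check b).run h).reg 0 = h.reg 0 ∨ ((check b).run h).reg 0 = 1 ∧ P.VSC b)) ∧
    (P.VSC b → ∃ a : ℕ → P.Event, ∀ h, Ready P h → (∀ i, i < b → h.reg (30 + i) = index (a i)) →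
      ((check b).run h).reg 0 = 1) := by
  have split : ∀ h : TState, Ready P h → ∃ g, Prepared P g ∧ Tracks (∅ : Set P.Event) g ∧
      g.reg 4 = 0 ∧ g.reg 0 = h.reg 0 ∧ (∀ i, g.reg (30 + i) = h.reg (30 + i)) ∧
      (check b).run h =
        (whenZero 4 (.const 0 1)).run ((rep 1 8 finalBody).run ((phases b).run g)) := by
    rintro h ⟨hh, D, ht⟩
    have p : Prepared P ((rep 1 8 resetBody).run h) := hh.run (by decide) (by decide)
    refine ⟨(Cmd.const 4 0).run ((rep 1 8 resetBody).run h), p.run (by decide) (by decide),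
      (run_reset hh ht).run (by decide) (by decide), by simp [run, TState.setReg], ?_, ?_, rfl⟩
    · rw [reg_run (by decide), reg_run (by decide)]
    · intro i
      have : ∀ r ∈ (rep 1 8 resetBody).regs, r < 20 := by decide
      rw [reg_run (by simp [regs]; omega), reg_run (fun h => by have := this _ h; omega)]
  have prep : ∀ g, Prepared P g → Prepared P ((phases b).run g) := fun g hg => hg.run
    (fun r hr h => by have := mem_regs_phases h; simp at hr; omega)
    (fun t ht h => by rcases mem_tabs_phases h with rfl | rfl | rfl <;> simp at ht)
  constructor
  · intro h hr ha
    obtain ⟨g, p, t, g4, g0, gi, hrun⟩ := split h hr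
    obtain ⟨D', t', hs⟩ := run_phases_sound hP b downClosed_empty p t
      fun i hi => (ha i hi).imp fun a h => (gi i).trans h
    have hf := run_final (prep g p) t'
    refine ⟨⟨hr.1.run ?_ ?_, D', ?_⟩, ?_⟩
    · exact fun r hr h => by have := (mem_regs_check h).1; simp at hr; omega
    · exact fun t ht h => by rcases mem_tabs_check h with rfl | rfl | rfl <;> simp at ht
    · rw [hrun]
      exact (t'.run (by decide) (by decide)).run (by decide) (by decide)
    · have h0 : ((rep 1 8 finalBody).run ((phases b).run g)).reg 0 = h.reg 0 := by
        rw [reg_run (by decide), reg_run (fun h => by have := mem_regs_phases h; omega), g0]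
      rw [hrun]
      by_cases h4 : ((rep 1 8 finalBody).run ((phases b).run g)).reg 4 = 0
      · right
        obtain ⟨f1, f2⟩ := hf.1 h4
        refine ⟨?_, (vsc_iff_completable hP).2 (hs f1 f2).2⟩
        rw [whenZero, run, if_neg (not_not.2 h4)]
        simp [run, TState.setReg]
      · left
        rw [whenZero, run, if_pos h4]
        exact h0
  · intro hV
    obtain ⟨a, ha⟩ := exists_guess hP b downClosed_empty ((vsc_iff_completable hP).1 hV)
    refine ⟨a, fun h hr hi => ?_⟩
    obtain ⟨g, p, t, g4, g0, gi, hrun⟩ := split h hr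
    obtain ⟨k1, k2⟩ := ha g p t g4 fun i hlt => (gi i).trans (hi i hlt)
    have h4 := (run_final (prep g p) k2).2 ⟨k1, rfl⟩
    rw [hrun, whenZero, run, if_neg (not_not.2 h4)]
    simp [run, TState.setReg]

theorem mem_regs_enumerate {A : Cmd} {t r : ℕ} (h : r ∈ (enumerate A t).regs) :
    r ∈ A.regs ∨ (30 ≤ r ∧ r < 30 + t) := by
  induction t with
  | zero => exact .inl h
  | succ t ih =>
    rw [enumerate, regs, List.mem_cons] at h
    rcases h with rfl | h
    · exact .inr ⟨by omega, by omega⟩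
    · rcases ih h with h | h
      · exact .inl h
      · exact .inr ⟨h.1, by omega⟩

theorem run_enumerate (hP : P.OneWriter) {b : ℕ} {a : ℕ → P.Event}
    (ha : P.VSC b → ∀ h, Ready P h → (∀ i, i < b → h.reg (30 + i) = index (a i)) →
      ((check b).run h).reg 0 = 1) (t : ℕ) (htb : t ≤ b) (h : TState) (hr : Ready P h)
    (hg : ∀ i, t ≤ i → i < b → ∃ a : P.Event, h.reg (30 + i) = index a) :
    Ready P ((enumerate (check b) t).run h) ∧
      (((enumerate (check b) t).run h).reg 0 = h.reg 0 ∨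
        ((enumerate (check b) t).run h).reg 0 = 1 ∧ P.VSC b) ∧
      (P.VSC b → (∀ i, t ≤ i → i < b → h.reg (30 + i) = index (a i)) →
        ((enumerate (check b) t).run h).reg 0 = 1) := by
  induction t generalizing h with
  | zero =>
    obtain ⟨k1, k2⟩ := (run_check hP b).1 h hr fun i => hg i (Nat.zero_le i)
    exact ⟨k1, k2, fun hV hi => ha hV h hr fun i => hi i (Nat.zero_le i)⟩
  | succ t ih =>
    have ready : ∀ (g : TState) (v : ℕ), Ready P g → Ready P (g.setReg (30 + t) v) := by
      rintro g v ⟨p, D, hD⟩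
      exact ⟨p.congr (fun r hr => g.setReg_reg_of_ne _ (by simp at hr; omega)) fun _ _ => rfl,
        D, hD.congr rfl rfl⟩
    have hnot : 30 + t ∉ (enumerate (check b) t).regs := fun h => by
      rcases mem_regs_enumerate h with h | h
      · have := (mem_regs_check h).2
        omega
      · omega
    -- The answer register is only ever left alone or set to one. If the outer guesses are the right
    -- ones, it is one as soon as the counter has passed `index (a t)`.
    have key := rep_induction (m := 1) (h := h) hnot
      (fun q g => Ready P g ∧ (g.reg 0 = h.reg 0 ∨ g.reg 0 = 1 ∧ P.VSC b) ∧
        (P.VSC b → (∀ i, t + 1 ≤ i → i < b → h.reg (30 + i) = index (a i)) → index (a t) < q →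
          g.reg 0 = 1))
      ⟨ready _ _ hr, .inl (by rw [TState.setReg_reg_of_ne _ _ (by omega)]), by simp⟩ ?_
    · rw [hr.1.events] at key
      exact ⟨key.1, key.2.1, fun hV hi => key.2.2 hV hi (index_lt _)⟩
    · rintro q g hq hgq hf ⟨i1, i2, i3⟩
      have hgi : ∀ i, t + 1 ≤ i → i < b → g.reg (30 + i) = h.reg (30 + i) := fun i hi _ =>
        hf.reg _ fun h => by
          rcases mem_regs_enumerate (t := t + 1) h with h | h
          · have := (mem_regs_check h).2
            omega
          · omega
      rw [hr.1.events] at hq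
      obtain ⟨e, rfl⟩ := exists_index_eq hq
      obtain ⟨k1, k2, k3⟩ := ih (by omega) g i1 fun i hi hib => by
        rcases hi.lt_or_eq with hlt | rfl
        · rw [hgi i hlt hib]
          exact hg i hlt hib
        · exact ⟨e, hgq⟩
      refine ⟨ready _ _ k1, ?_, ?_⟩
      · rw [TState.setReg_reg_of_ne _ _ (by omega)]
        rcases k2 with k2 | k2
        · rwa [k2]
        · exact .inr k2
      · intro hV hi hlt
        rw [TState.setReg_reg_of_ne _ _ (by omega)]
        rcases index_lt_succ_iff.1 hlt with heq | hlt
        · refine k3 hV fun i hti hib => ?_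
          rcases hti.lt_or_eq with hlt | rfl
          · rw [hgi i hlt hib, hi i hlt hib]
          · rw [hgq, heq]
        · have h1 := i3 hV hi hlt
          rcases k2 with k2 | k2
          · rw [k2, h1]
          · exact k2.1

/-! ### Reading the input -/

/-- The encoding of a list of threads. -/
def encodeThreads (Ts : List (List MemOp)) : List ℕ :=
  Ts.flatMap fun S => S.length :: S.flatMap MemOp.encode

theorem encodeThreads_cons (S : List MemOp) (Ts : List (List MemOp)) :
    encodeThreads (S :: Ts) = S.length :: (S.flatMap MemOp.encode ++ encodeThreads Ts) := by
  simp [encodeThreads]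

theorem encode_eq (P : ConcProg) : P.encode = P.threads.length :: encodeThreads P.threads := rfl

theorem length_encode_ops (S : List MemOp) : (S.flatMap MemOp.encode).length = 3 * S.length := by
  induction S with
  | nil => rfl
  | cons o S ih => cases o <;> simp [MemOp.encode, ih] <;> ring

theorem getD_of_drop {l : List ℕ} {p v : ℕ} {r : List ℕ} (h : l.drop p = v :: r) :
    p < l.length ∧ l.getD p 0 = v ∧ l.drop (p + 1) = r := by
  have hp : p < l.length := by
    by_contra hp
    rw [List.drop_eq_nil_of_le (by omega)] at h
    cases h
  rw [List.drop_eq_getElem_cons hp] at h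
  cases h
  exact ⟨hp, by simp [hp], rfl⟩

/-- The tables describe the operation `o` of the thread with label `l` as event `j`. -/
def Entry (g : TState) (j : ℕ) (lo : ℕ × MemOp) : Prop :=
  g.tab 0 j = lo.1 ∧ ∃ d, g.tab 3 j = d + 1 ∧ lo.2.encode = [g.tab 1 j, g.tab 2 j, d]

theorem run_parseTail {g : TState} {p : ℕ} (h3 : g.reg 3 = 1) (hp : g.reg 20 = p)
    (hb : p + 2 < g.base) :
    (parseTail.run g).tab 0 = Function.update (g.tab 0) (g.reg 8) (g.reg 22) ∧
    (parseTail.run g).tab 1 = Function.update (g.tab 1) (g.reg 8) (g.inp p) ∧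
    (parseTail.run g).tab 2 = Function.update (g.tab 2) (g.reg 8) (g.inp (p + 1)) ∧
    (parseTail.run g).tab 3 = Function.update (g.tab 3) (g.reg 8) (g.inp (p + 2) + 1) ∧
    (parseTail.run g).reg 20 = p + 3 ∧ (parseTail.run g).reg 21 = g.reg 21 - 1 ∧
    (parseTail.run g).reg 22 = g.reg 22 := by
  have h0 : p < g.base := by omega
  have h1 : p + 1 < g.base := by omega
  refine ⟨?_, ?_, ?_, ?_, ?_, ?_, ?_⟩ <;>
  simp [parseTail, run, TState.setReg, TState.setTab, TState.cell, h3, hp, h0, h1, hb, add_assoc]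

/-- The invariant of the parsing loop. -/
def ParseInv (P : ConcProg) (i : ℕ) (g : TState) : Prop :=
  (∃ (S : List MemOp) (Ts : List (List MemOp)),
      P.encode.drop (g.reg 20) = S.flatMap MemOp.encode ++ encodeThreads Ts ∧
    g.reg 21 = S.length ∧
    (labelled 1 P.threads).drop i = S.map (fun o => (g.reg 22, o)) ++ labelled (g.reg 22 + 1) Ts ∧
    ∀ T ∈ Ts, T ≠ []) ∧
  ∀ j, j < i → ∀ lo, (labelled 1 P.threads)[j]? = some lo → Entry g j lo

/-- Since threads are nonempty, opening at most one new thread always exposes an operation, so a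
conditional suffices where otherwise a loop would be needed. -/
theorem parseInv_head {i : ℕ} {g : TState} (hi : i < P.numEvents) (h3 : g.reg 3 = 1)
    (hb : g.base = P.encode.length) (hin : g.inp = fun a => P.encode.getD a 0)
    (hI : ParseInv P i g) :
    ParseInv P i (parseHead.run g) ∧ (parseHead.run g).reg 21 ≠ 0 := by
  by_cases h21 : g.reg 21 = 0
  · obtain ⟨⟨S, Ts, k1, k2, k3, k4⟩, k5⟩ := hI
    obtain rfl : S = [] := List.length_eq_zero_iff.1 (k2.symm.trans h21)
    cases Ts with
    -- No thread left would mean that all `P.numEvents` operations have been read, against `hi`.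
    | nil =>
      have := congrArg List.length k3
      rw [List.length_drop, length_labelled] at this
      simp only [labelled, List.map_nil, List.append_nil, List.length_nil] at this
      unfold numEvents at hi
      omega
    | cons T Ts =>
      rw [encodeThreads_cons] at k1
      obtain ⟨d1, d2, d3⟩ := getD_of_drop k1
      have d2' : P.encode[g.reg 20] = T.length := by rw [← d2, List.getD_eq_getElem]
      have r21 : (parseHead.run g).reg 21 = T.length := by
        simp only [parseHead, whenZero, run, h21, TState.setReg, TState.cell]
        simp [hb, d1, hin, d2']
      have r22 : (parseHead.run g).reg 22 = g.reg 22 + 1 := by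
        simp [parseHead, whenZero, run, h21, TState.setReg, h3]
      have r20 : (parseHead.run g).reg 20 = g.reg 20 + 1 := by
        simp [parseHead, whenZero, run, h21, TState.setReg, h3]
      refine ⟨⟨⟨T, Ts, ?_, r21, ?_, fun U hU => k4 U (by simp [hU])⟩, ?_⟩, ?_⟩
      · rw [r20, d3]
      · rw [r22, k3]
        simp [labelled]
      · intro j hj lo hlo
        have := k5 j hj lo hlo
        unfold Entry at this ⊢
        simpa only [tab_run (c := parseHead) (t := 0) (by decide),
          tab_run (c := parseHead) (t := 1) (by decide),
          tab_run (c := parseHead) (t := 2) (by decide),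
          tab_run (c := parseHead) (t := 3) (by decide)] using this
      · rw [r21]
        exact (List.length_pos_of_ne_nil (k4 T (by simp))).ne'
  · have : parseHead.run g = g := by simp [parseHead, whenZero, run, h21]
    rw [this]
    exact ⟨hI, h21⟩

theorem parseInv_tail {i : ℕ} {g : TState} (h3 : g.reg 3 = 1) (h8 : g.reg 8 = i)
    (hb : g.base = P.encode.length) (hin : g.inp = fun a => P.encode.getD a 0)
    (hI : ParseInv P i g) (h21 : g.reg 21 ≠ 0) :
    ParseInv P (i + 1) (parseTail.run g) := by
  obtain ⟨⟨S, Ts, k1, k2, k3, k4⟩, k5⟩ := hI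
  cases S with
  | nil => exact (h21 k2).elim
  | cons o S =>
    obtain ⟨κ, x, d, ho⟩ : ∃ κ x d, o.encode = [κ, x, d] := by
      cases o <;> exact ⟨_, _, _, rfl⟩
    rw [List.flatMap_cons, ho] at k1
    simp only [List.cons_append, List.nil_append] at k1
    obtain ⟨-, d1, k1⟩ := getD_of_drop k1
    obtain ⟨-, d2, k1⟩ := getD_of_drop k1
    obtain ⟨d0, d3, k1⟩ := getD_of_drop k1
    obtain ⟨t0, t1, t2, t3, r20, r21, r22⟩ := run_parseTail h3 rfl (by rw [hb]; exact d0)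
    rw [List.map_cons, List.cons_append] at k3
    have hlo : (labelled 1 P.threads)[i]? = some (g.reg 22, o) := by
      rw [← List.head?_drop, k3]
      rfl
    refine ⟨⟨S, Ts, ?_, ?_, ?_, k4⟩, ?_⟩
    · rw [r20]
      exact k1
    · rw [r21, k2]
      simp
    · rw [r22, ← List.tail_drop, k3]
      rfl
    · intro j hj lo hj'
      unfold Entry
      rw [t0, t1, t2, t3, h8, hin]
      by_cases hji : j = i
      · subst hji
        rw [hlo] at hj'
        cases hj'
        simp only [Function.update_self]
        exact ⟨trivial, d, by rw [show g.reg 20 + 2 = g.reg 20 + 1 + 1 from rfl, d3],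
          by rw [ho, d1, d2]⟩
      · simp only [Function.update_of_ne hji]
        exact k5 j (by omega) lo hj'

theorem run_parseLoop {h : TState} (h1 : h.reg 1 = P.numEvents) (h2 : h.reg 2 = P.numThreads)
    (h3 : h.reg 3 = 1) (hb : h.base = P.encode.length)
    (hin : h.inp = fun a => P.encode.getD a 0) (h20 : h.reg 20 = 1) (h21 : h.reg 21 = 0)
    (h22 : h.reg 22 = 0) : Loaded P ((rep 1 8 parseBody).run h) := by
  -- The invariant starts with an exhausted fictitious thread of label zero, so that the first
  -- iteration opens the first thread with label one.
  have key := rep_induction (m := 1) (j := 8) (A := parseBody) (h := h) (by decide) (ParseInv P)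
    ⟨⟨[], P.threads, ?_, ?_, ?_, P.thread_ne⟩, by simp⟩ ?_
  · rw [h1] at key
    have entry : ∀ e : P.Event, Entry ((rep 1 8 parseBody).run h) (index e)
        (e.1.val + 1, P.op e) := fun e => key.2 _ (index_lt e) _ (labelled_index e)
    refine ⟨(reg_run (by decide) h).trans h1, (reg_run (by decide) h).trans h2,
      (reg_run (by decide) h).trans h3, fun e => (entry e).1, fun e x d hop => ?_,
      fun e x d hop => ?_⟩
    · obtain ⟨-, d', k1, k2⟩ := entry e
      simp only [hop, MemOp.encode, List.cons.injEq, and_true] at k2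
      obtain ⟨j1, j2, rfl⟩ := k2
      exact ⟨j1.symm, j2.symm, k1⟩
    · obtain ⟨-, d', k1, k2⟩ := entry e
      simp only [hop, MemOp.encode, List.cons.injEq, and_true] at k2
      obtain ⟨j1, j2, rfl⟩ := k2
      exact ⟨j1.symm, j2.symm, k1⟩
  · rw [TState.setReg_reg_of_ne _ _ (by decide), h20]
    rfl
  · rw [TState.setReg_reg_of_ne _ _ (by decide), h21]
    rfl
  · rw [TState.setReg_reg_of_ne _ _ (by decide), h22]
    rfl
  · intro i g hi hg hf hI
    have hf' := frame_run parseHead g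
    have g3 : g.reg 3 = 1 := (hf.reg 3 (by decide)).trans h3
    obtain ⟨k1, k2⟩ := parseInv_head (h1 ▸ hi) g3 (hf.base.trans hb) (hf.inp.trans hin) hI
    have k3 := parseInv_tail ((hf'.reg 3 (by decide)).trans g3) ((hf'.reg 8 (by decide)).trans hg)
      (hf'.base.trans (hf.base.trans hb)) (hf'.inp.trans (hf.inp.trans hin)) k1 k2
    have hrun : parseBody.run g = parseTail.run (parseHead.run g) := rfl
    rw [hrun]
    unfold ParseInv Entry at k3 ⊢
    simpa only [TState.setReg_tab, TState.setReg_reg_of_ne _ _ (show 20 ≠ 8 by decide),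
      TState.setReg_reg_of_ne _ _ (show 21 ≠ 8 by decide),
      TState.setReg_reg_of_ne _ _ (show 22 ≠ 8 by decide)] using k3

/-- After `q` events, table `6` holds the values left by the down-closed set of events of index
below `q`; at the end this is the set of all events. -/
theorem run_ownerLoop (hP : P.OneWriter) {h : TState} (hh : Loaded P h) (h5 : h.tab 5 = fun _ => 0)
    (h6 : h.tab 6 = fun _ => 0) : Prepared P ((rep 1 8 ownerBody).run h) := by
  have key := rep_events (A := ownerBody) hh.events (by decide)
    (fun q g => (∀ (e : P.Event) x d, index e < q → P.op e = .write x d →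
        g.tab 5 x = e.1.val + 1) ∧
      (∀ x, (∀ (e : P.Event) d, index e < q → P.op e ≠ .write x d) → g.tab 5 x = 0) ∧
      ∀ x d, g.tab 6 x = d + 1 ↔ Holds {e : P.Event | index e < q} x d)
    (by simp [h5, h6, Holds]) ?_
  · obtain ⟨k1, k2, k3⟩ := key
    refine ⟨hh.congr (fun r hr => reg_run ?_ h) fun t ht => tab_run ?_ h,
      fun e x d => k1 e x d (index_lt e), fun x hx => k2 x fun e d _ => hx e d, ?_⟩
    · revert r
      decide
    · revert t
      decide
    · simpa [index_lt] using k3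
  · rintro e g hg hf ⟨i1, i2, i3⟩
    have hgL : Loaded P g := hh.congr (fun r hr => hf.reg r (by revert r; decide))
      fun t ht => hf.tab t (by revert t; decide)
    have hins : {f : P.Event | index f < index e + 1} =
        insert e {f : P.Event | index f < index e} := by
      ext f
      exact index_lt_succ_iff
    rw [hins]
    simp only [TState.setReg_tab, index_lt_succ_iff]
    cases hop : P.op e with
    | read x d =>
      have h0 := (hgL.read e x d hop).1
      have t5 : (ownerBody.run g).tab 5 = g.tab 5 := by
        simp [ownerBody, whenNonzero, run, TState.setReg, hg, h0]
      have t6 : (ownerBody.run g).tab 6 = g.tab 6 := by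
        simp [ownerBody, whenNonzero, run, TState.setReg, hg, h0]
      rw [t5, t6]
      refine ⟨?_, fun y hy => i2 y fun f d hf => hy f d (.inr hf), fun y d' => ?_⟩
      · rintro f y d' (rfl | hf) hfw
        · rw [hop] at hfw
          cases hfw
        · exact i1 f y d' hf hfw
      · rw [i3, holds_insert_of_ne (by simp [hop])]
    | write x d =>
      obtain ⟨k1, k2, k3⟩ := hgL.write e x d hop
      have t5 : (ownerBody.run g).tab 5 = Function.update (g.tab 5) x (e.1.val + 1) := by
        simp [ownerBody, whenNonzero, run, TState.setReg, TState.setTab, hg, k1, k2, hgL.label]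
      have t6 : (ownerBody.run g).tab 6 = Function.update (g.tab 6) x (d + 1) := by
        simp [ownerBody, whenNonzero, run, TState.setReg, TState.setTab, hg, k1, k2, k3]
      rw [t5, t6]
      refine ⟨?_, fun y hy => ?_, fun y d' => ?_⟩
      · intro f y d' hf hfw
        by_cases hy : y = x
        · subst hy
          rw [Function.update_self, hP f e y d' d hfw hop]
        · rw [Function.update_of_ne hy]
          rcases hf with rfl | hf
          · rw [hop] at hfw
            cases hfw
            exact (hy rfl).elim
          · exact i1 f y d' hf hfw
      · have hyx : y ≠ x := fun h => hy e d (.inl rfl) (h ▸ hop)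
        rw [Function.update_of_ne hyx]
        exact i2 y fun f d' hf => hy f d' (.inr hf)
      · by_cases hy : y = x
        · subst hy
          rw [holds_insert_write hP hop, Function.update_self]
          · simp [eq_comm]
          · intro f hf hpo
            have := index_lt_of_programOrder hpo
            have hf : index f < index e := hf
            omega
        · rw [holds_insert_of_ne (by simp [hop]; intro h; exact (hy h.symm).elim), ← i3,
            Function.update_of_ne hy]

theorem run_parse (hP : P.OneWriter) {h : TState} (h1 : h.reg 1 = P.numEvents)
    (h2 : h.reg 2 = P.numThreads) (hb : h.base = P.encode.length)
    (hin : h.inp = fun a => P.encode.getD a 0) (ht : h.tab = fun _ _ => 0) :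
    Ready P (parse.run h) := by
  let g := (((h.setReg 3 1).setReg 20 1).setReg 21 0).setReg 22 0
  have hrun : parse.run h = (rep 1 8 ownerBody).run ((rep 1 8 parseBody).run g) := rfl
  have hl : Loaded P ((rep 1 8 parseBody).run g) :=
    run_parseLoop (by simp [g, TState.setReg, h1]) (by simp [g, TState.setReg, h2])
      (by simp [g, TState.setReg]) hb hin (by simp [g, TState.setReg]) (by simp [g, TState.setReg])
      (by simp [g, TState.setReg])
  have hz : ∀ t : Fin 16, t ∉ (rep 1 8 parseBody).tabs →
      ((rep 1 8 parseBody).run g).tab t = fun _ => 0 := fun t h => by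
    rw [tab_run h]
    exact congrFun ht t
  rw [hrun]
  refine ⟨run_ownerLoop hP hl (hz 5 (by decide)) (hz 6 (by decide)), ∅, ?_, ?_⟩
  · intro e
    rw [tab_run (by decide), hz 4 (by decide)]
    simp
  · intro x d
    rw [tab_run (by decide), hz 7 (by decide)]
    simp [Holds]

theorem run_decideVSC (hP : P.OneWriter) (b : ℕ) {h : TState} (h0 : h.reg 0 = 0)
    (h1 : h.reg 1 = P.numEvents) (h2 : h.reg 2 = P.numThreads) (hb : h.base = P.encode.length)
    (hin : h.inp = fun a => P.encode.getD a 0) (ht : h.tab = fun _ _ => 0) :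
    (P.VSC b → ((decideVSC b).run h).reg 0 = 1) ∧
      (¬ P.VSC b → ((decideVSC b).run h).reg 0 = 0) := by
  have hr := run_parse hP h1 h2 hb hin ht
  have hz : (parse.run h).reg 0 = 0 := (reg_run (by decide) h).trans h0
  have e₀ : P.Event := ⟨⟨0, List.length_pos_of_ne_nil P.threads_ne⟩, ⟨0, List.length_pos_of_ne_nil
    (P.thread_ne _ (List.get_mem _ _))⟩⟩
  -- If the answer is no, the tuple is irrelevant and a constant one serves.
  obtain ⟨a, ha⟩ : ∃ a : ℕ → P.Event, P.VSC b → ∀ h, Ready P h →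
      (∀ i, i < b → h.reg (30 + i) = index (a i)) → ((check b).run h).reg 0 = 1 := by
    by_cases hV : P.VSC b
    · exact ((run_check hP b).2 hV).imp fun a ha _ => ha
    · exact ⟨fun _ => e₀, fun h => (hV h).elim⟩
  obtain ⟨-, k2, k3⟩ := run_enumerate hP ha b le_rfl (parse.run h) hr (fun i _ _ => by omega)
  refine ⟨fun hV => k3 hV (fun i _ _ => by omega), fun hV => ?_⟩
  rcases k2 with k2 | k2
  · exact k2.trans hz
  · exact (hV k2.2).elim

/-! ### The running time -/

theorem limits_phases (t : ℕ) : ∀ r ∈ (phases t).limits, r ∈ [1, 2] := by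
  have hs : ∀ r ∈ saturate.limits, r ∈ [1, 2] := by decide
  have hb : ∀ r ∈ runBlock.limits, r ∈ [1, 2] := by decide
  induction t with
  | zero => exact hs
  | succ t ih =>
    intro r h
    simp only [phases, limits, List.mem_append, List.not_mem_nil, false_or] at h
    rcases h with h | h | h
    · exact hs r h
    · exact hb r h
    · exact ih r h

theorem limits_enumerate {A : Cmd} (hA : ∀ r ∈ A.limits, r ∈ [1, 2]) (t : ℕ) :
    ∀ r ∈ (enumerate A t).limits, r ∈ [1, 2] := by
  induction t with
  | zero => exact hA
  | succ t ih =>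
    intro r h
    rw [enumerate, limits, List.mem_cons] at h
    rcases h with rfl | h
    · decide
    · exact ih r h

theorem limits_decideVSC (b : ℕ) : ∀ r ∈ (decideVSC b).limits, r ∈ [1, 2] := by
  have hp : ∀ r ∈ parse.limits, r ∈ [1, 2] := by decide
  have h1 : (rep 1 8 resetBody).limits = [1] := rfl
  have h2 : (rep 1 8 finalBody).limits = [1] := rfl
  have h3 : (whenZero 4 (.const 0 1)).limits = [] := rfl
  have hc : ∀ r ∈ (check b).limits, r ∈ [1, 2] := by
    intro r h
    rw [check, limits, limits, limits, limits, h1, h2, h3] at h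
    simp only [limits, List.mem_append, List.not_mem_nil, List.mem_singleton, false_or,
      or_false] at h
    rcases h with rfl | h | rfl
    · decide
    · exact limits_phases b r h
    · decide
  intro r h
  rw [decideVSC, limits, List.mem_append] at h
  exact h.elim (hp r) (limits_enumerate hc b r)

theorem not_mem_regs_decideVSC (b : ℕ) : ∀ r ∈ [1, 2], r ∉ (decideVSC b).regs := by
  have hp : ∀ r ∈ [1, 2], r ∉ parse.regs := by decide
  intro r hr h
  rw [decideVSC, mem_regs_seq] at h
  rcases h with h | h
  · exact hp r hr h
  · simp only [List.mem_cons, List.not_mem_nil, or_false] at hr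
    rcases mem_regs_enumerate h with h | h
    · have := (mem_regs_check h).1
      omega
    · omega

variable {v : ℕ → ℕ}

/-- Unfolded, the bound is linear in `v 1` with numerical coefficients; `1000` is a generous choice,
and `h1` absorbs the constant term. -/
theorem bound_roundCmd (h1 : 1 ≤ v 1) : roundCmd.bound v ≤ 1000 * v 1 := by
  simp only [roundCmd, markAllBody, unmarkBody, markBody, pickBody, runBlock, blockBody, execEvent,
    neq, whenZero, whenNonzero, bound]
  omega

theorem bound_runBlock (h1 : 1 ≤ v 1) : runBlock.bound v ≤ 1000 * v 1 := by
  simp only [runBlock, blockBody, execEvent, neq, whenZero, whenNonzero, bound]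
  omega

theorem bound_parse (h1 : 1 ≤ v 1) : parse.bound v ≤ 1000 * v 1 := by
  simp only [parse, parseBody, parseHead, parseTail, ownerBody, whenZero, whenNonzero, bound]
  omega

/-- Each of the `v 2` rounds costs at most `1000 * v 1 + 3`, and the loop itself three more steps:
hence `1000 + 3 + 3`. -/
theorem bound_saturate (h1 : 1 ≤ v 1) (h2 : 1 ≤ v 2) : saturate.bound v ≤ 1006 * (v 1 * v 2) := by
  have h := bound_roundCmd h1
  simp only [saturate, bound]
  nlinarith [Nat.mul_le_mul_left (v 2) h, Nat.mul_le_mul h1 h2, Nat.mul_le_mul_right (v 2) h1]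

theorem bound_phases (h1 : 1 ≤ v 1) (h2 : 1 ≤ v 2) (t : ℕ) :
    (phases t).bound v ≤ (t + 1) * (3000 * (v 1 * v 2)) := by
  have hs := bound_saturate h1 h2
  have hb := bound_runBlock h1
  have hle : v 1 ≤ v 1 * v 2 := Nat.le_mul_of_pos_right _ h2
  induction t with
  | zero =>
    rw [phases]
    omega
  | succ t ih =>
    simp only [phases, bound]
    rw [add_mul (t + 1) 1]
    omega

theorem bound_check (h1 : 1 ≤ v 1) (h2 : 1 ≤ v 2) (b : ℕ) :
    (check b).bound v ≤ (b + 1) * (4000 * (v 1 * v 2)) := by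
  have hp := bound_phases h1 h2 b
  have hle : v 1 ≤ v 1 * v 2 := Nat.le_mul_of_pos_right _ h2
  have : (b + 1) * (4000 * (v 1 * v 2)) =
      (b + 1) * (3000 * (v 1 * v 2)) + 1000 * (b * (v 1 * v 2)) + 1000 * (v 1 * v 2) := by ring
  rw [this]
  simp only [check, resetBody, finalBody, whenZero, bound]
  omega

/-- A further loop level adds `3 * v 1 + 3`, which is at most `6 * v 1 ^ (t + 1)`; this is the
source of the summand `6 * t`. -/
theorem bound_enumerate (h1 : 1 ≤ v 1) (A : Cmd) (t : ℕ) :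
    (enumerate A t).bound v ≤ v 1 ^ t * (A.bound v + 6 * t) := by
  induction t with
  | zero => simp [enumerate]
  | succ t ih =>
    simp only [enumerate, bound]
    have h2 : 1 ≤ v 1 ^ t := Nat.one_le_pow _ _ h1
    have h3 : v 1 ≤ v 1 * v 1 ^ t := Nat.le_mul_of_pos_right _ h2
    calc 3 + v 1 * ((enumerate A t).bound v + 3)
        ≤ 3 + v 1 * (v 1 ^ t * (A.bound v + 6 * t) + 3) := by gcongr
      _ = v 1 * v 1 ^ t * (A.bound v + 6 * t) + 3 * v 1 + 3 := by ring
      _ ≤ v 1 * v 1 ^ t * (A.bound v + 6 * t) + 6 * (v 1 * v 1 ^ t) := by omega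
      _ = v 1 ^ (t + 1) * (A.bound v + 6 * (t + 1)) := by ring

/-- The constant is `1000` for parsing, `2 * 4000` for the tests, where `b + 1` is at most twice
`max b 1`, and `6` for the enumeration loops. -/
theorem bound_decideVSC (h1 : 1 ≤ v 1) (h2 : 1 ≤ v 2) (b : ℕ) :
    (decideVSC b).bound v ≤ 9006 * (v 1 ^ (b + 1) * v 2 * max b 1) := by
  have hc := bound_check h1 h2 b
  have he := bound_enumerate h1 (check b) b
  have hp := bound_parse h1
  have hm1 : 1 ≤ max b 1 := le_max_right _ _
  have hmb : b ≤ max b 1 := le_max_left _ _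
  generalize max b 1 = m at *
  have hN : 1 ≤ v 1 * v 2 := Nat.mul_pos h1 h2
  have hpow : 1 ≤ v 1 ^ b := Nat.one_le_pow _ _ h1
  calc (decideVSC b).bound v = parse.bound v + (enumerate (check b) b).bound v := rfl
    _ ≤ 1000 * (v 1 * 1 * 1 * 1) +
        v 1 ^ b * ((m + m) * (4000 * (v 1 * v 2)) + 6 * (m * (v 1 * v 2))) := by
      refine add_le_add (by simpa using hp) (he.trans (Nat.mul_le_mul_left _ (add_le_add ?_ ?_)))
      · exact hc.trans (Nat.mul_le_mul_right _ (by omega))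
      · exact Nat.mul_le_mul_left _ (hmb.trans (Nat.le_mul_of_pos_right _ hN))
    _ ≤ 1000 * (v 1 * v 1 ^ b * v 2 * m) +
        v 1 ^ b * ((m + m) * (4000 * (v 1 * v 2)) + 6 * (m * (v 1 * v 2))) := by gcongr
    _ = 9006 * (v 1 ^ (b + 1) * v 2 * m) := by ring

/-! ### Preparation of the machine -/

/-- One step through the threads: add the length of the thread to register `2` and move the
pointer in register `7` to the next thread. -/
def skipThread : Prog :=
  .seq (.load 11 7) (.seq (.add 2 2 11) (.seq (.add 7 7 1) (.seq (.add 7 7 11) (.seq (.add 7 7 11)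
    (.seq (.add 7 7 11) (.sub 9 9 1))))))

/-- Compute the number of threads, the number of events and the length of the input. -/
def measure : Prog :=
  .seq (.const 1 1) (.seq (.const 3 0) (.seq (.load 4 3) (.seq (.move 9 4) (.seq (.move 7 1)
    (.loop 9 skipThread)))))

theorem exec_skipThread (s : State) : ∃ s', Exec skipThread s s' 7 ∧ s'.mem = s.mem ∧
    s'.reg 0 = s.reg 0 ∧ s'.reg 1 = s.reg 1 ∧ s'.reg 4 = s.reg 4 ∧
    s'.reg 2 = s.reg 2 + s.mem (s.reg 7) ∧
    s'.reg 7 = s.reg 7 + s.reg 1 + 3 * s.mem (s.reg 7) ∧ s'.reg 9 = s.reg 9 - s.reg 1 := by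
  refine ⟨_, .seq (.load _ _ _) (.seq (.add _ _ _ _) (.seq (.add _ _ _ _) (.seq (.add _ _ _ _)
    (.seq (.add _ _ _ _) (.seq (.add _ _ _ _) (.sub _ _ _ _)))))), ?_⟩
  simp [State.setReg]
  ring

theorem exec_skipThreads {l : List ℕ} (Ts : List (List MemOp)) (s : State)
    (hm : s.mem = fun a => l.getD a 0) (h1 : s.reg 1 = 1) (h9 : s.reg 9 = Ts.length)
    (h7 : l.drop (s.reg 7) = encodeThreads Ts) :
    ∃ s', Exec (.loop 9 skipThread) s s' (1 + 8 * Ts.length) ∧ s'.mem = s.mem ∧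
      s'.reg 0 = s.reg 0 ∧ s'.reg 1 = 1 ∧ s'.reg 4 = s.reg 4 ∧
      s'.reg 2 = s.reg 2 + (Ts.map List.length).sum ∧
      s'.reg 7 = s.reg 7 + (encodeThreads Ts).length := by
  induction Ts generalizing s with
  | nil => exact ⟨s, .loop_done h9, rfl, rfl, h1, rfl, rfl, rfl⟩
  | cons S Ts ih =>
    rw [encodeThreads_cons] at h7
    obtain ⟨-, d2, d3⟩ := getD_of_drop h7
    obtain ⟨s₁, e₁, m₁, r0, r1, r4, r2, r7, r9⟩ := exec_skipThread s
    have hS : s.mem (s.reg 7) = S.length := by rw [hm]; exact d2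
    rw [hS] at r2 r7
    rw [h1] at r7 r9 r1
    have hd : l.drop (s₁.reg 7) = encodeThreads Ts := by
      rw [r7, ← List.drop_drop, d3, ← length_encode_ops, List.drop_left]
    obtain ⟨s₂, e₂, m₂, q0, q1, q4, q2, q7⟩ := ih s₁ (m₁.trans hm) r1
      (by rw [r9, h9]; simp) hd
    refine ⟨s₂, ?_, m₂.trans m₁, q0.trans r0, q1, q4.trans r4, ?_, ?_⟩
    · have := Exec.loop_step (r := 9) (by rw [h9]; simp) e₁ e₂
      rw [show 1 + 8 * (S :: Ts).length = 7 + (1 + 8 * Ts.length) + 1 by simp; omega]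
      exact this
    · rw [q2, r2, List.map_cons, List.sum_cons]
      omega
    · rw [q7, r7, encodeThreads_cons, List.length_cons, List.length_append, length_encode_ops]
      omega

/-- Machine registers `2` and `4` are registers `1` and `2` of the table language, so they must hold
the numbers of events and threads. The pointer in register `7` stops at the end of the input, which
is the base of the tables. -/
theorem exec_measure (P : ConcProg) :
    ∃ (s : State) (h : TState), Exec measure (init P.encode) s (6 + 8 * P.numThreads) ∧
      Represents h s ∧ h.reg 0 = 0 ∧ h.reg 1 = P.numEvents ∧ h.reg 2 = P.numThreads ∧
      h.base = P.encode.length ∧ (h.inp = fun a => P.encode.getD a 0) ∧ h.tab = fun _ _ => 0 := by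
  let s₀ : State := (((((init P.encode).setReg 1 1).setReg 3 0).setReg 4 P.numThreads).setReg 9
    P.numThreads).setReg 7 1
  obtain ⟨s, e, m, r0, r1, r4, r2, r7⟩ := exec_skipThreads (l := P.encode) P.threads s₀ rfl
    (by simp [s₀, State.setReg]) (by simp [s₀, State.setReg, numThreads])
    (by simp [s₀, State.setReg, encode_eq])
  have hm : s.mem = fun a => P.encode.getD a 0 := m
  have h7 : s.reg 7 = P.encode.length := by
    rw [r7, encode_eq, List.length_cons]
    simp [s₀, State.setReg, add_comm]
  refine ⟨s, ⟨fun r => s.reg (2 * r), fun _ _ => 0, fun a => P.encode.getD a 0,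
    P.encode.length⟩, ?_, ⟨fun _ => rfl, r1, h7, fun t i => ?_, fun a _ => by rw [hm]⟩, ?_, ?_, ?_,
    rfl, rfl, rfl⟩
  · rw [show 6 + 8 * P.numThreads = 1 + (1 + (1 + (1 + (1 + (1 + 8 * P.threads.length))))) by
      unfold numThreads; omega]
    exact .seq (.const _ _ _) (.seq (.const _ _ _) (.seq (.load _ _ _) (.seq (.move _ _ _)
      (.seq (.move _ _ _) e))))
  · rw [hm]
    exact List.getD_eq_default _ _ (by simp only; omega)
  · refine r0.trans ?_
    simp [s₀, State.setReg, init]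
  · refine r2.trans ?_
    simp [s₀, State.setReg, init, numEvents]
  · refine r4.trans ?_
    simp [s₀, State.setReg]

end RAM

/-! ### Assembly of the machine program -/

open RAM ConcProg in
theorem theorem1 :
    ∃ C : ℕ, ∀ b : ℕ, ∃ A : RAM.Prog, ∀ P : ConcProg, P.OneWriter →
      RAM.AnswersWithin A P.encode (P.VSC b)
        (C * (P.numEvents ^ (b + 1) * P.numThreads * max b 1 * Nat.factorial b)) := by
  -- The preparation takes `6 + 8 * P.numThreads` steps, at most `14 * P.numThreads`; with the
  -- `9006` of the procedure this gives `9020`.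
  refine ⟨9020, fun b => ⟨.seq measure ((decideVSC b).compile 0), fun P hP => ?_⟩⟩
  obtain ⟨s, h, e, hs, h0, h1, h2, hb, hin, ht⟩ := exec_measure P
  obtain ⟨s', e', hs', -⟩ := exec_compile (decideVSC b) 0 h s hs
  obtain ⟨k1, k2⟩ := run_decideVSC hP b h0 h1 h2 hb hin ht
  have hr : s'.reg 0 = ((decideVSC b).run h).reg 0 := hs'.reg 0
  refine ⟨s', _, .seq e e', ?_, fun hV => hr.trans (k1 hV), fun hV => hr.trans (k2 hV)⟩
  have hk : 1 ≤ P.numThreads := List.length_pos_of_ne_nil P.threads_ne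
  have hn : 1 ≤ P.numEvents := by
    obtain ⟨a, -⟩ := exists_event (⟨0, hk⟩ : Fin P.threads.length)
    exact Nat.one_le_of_lt (index_lt a)
  have hc := (decideVSC b).cost_le_bound h.reg [1, 2] (limits_decideVSC b)
    (not_mem_regs_decideVSC b) h fun _ _ => rfl
  have hbd := bound_decideVSC (v := h.reg) (h1 ▸ hn) (h2 ▸ hk) b
  rw [h1, h2] at hbd
  have hm1 : 1 ≤ max b 1 := le_max_right _ _
  have hpow : 1 ≤ P.numEvents ^ (b + 1) := Nat.one_le_pow _ _ hn
  have hle : P.numThreads ≤ P.numEvents ^ (b + 1) * P.numThreads * max b 1 := by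
    calc P.numThreads = 1 * P.numThreads * 1 := by ring
      _ ≤ _ := by gcongr
  -- The estimate holds without the factorial, which enters only as a factor of at least one.
  have hf : P.numEvents ^ (b + 1) * P.numThreads * max b 1 ≤
      P.numEvents ^ (b + 1) * P.numThreads * max b 1 * b.factorial :=
    Nat.le_mul_of_pos_right _ (Nat.factorial_pos b)
  omega
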